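/- Let $\mathcal W=W(2,2)$ be the complex Lie algebra with basis $\{L_n,W_n,z\mid n\in\mathbb Z\}$ and brackets $$[L_n,L_m]=(m-n)L_{m+n}+\tfrac{n^3-n}{12}\delta_{m+n,0}\,z,\qquad [L_n,W_m]=(m-n)W_{m+n}+\tfrac{n^3-n}{12}\delta_{m+n,0}\,z,$$ $$[W_n,W_m]=[z,W_m]=[z,L_m]=0,$$ and let $\mathcal W_+$ be the subalgebra spanned by all $L_n,W_n$ with $n>0$. Let $\varphi:\mathcal W_+\to\mathbb C$ be a Lie algebra homomorphism that is non-singular, i.e. $\varphi(L_i)\varphi(W_i)\neq0$ for $i=1,2$. Write $U(\cdot)$ for universal enveloping algebras and $S(z)=\mathbb C[z]$ for the algebra of polynomials in $z$. Let $M_\varphi=U(\mathcal W)\otimes_{U(\mathcal W_+)}\mathbb C_\varphi$, where $\mathbb C_\varphi$ is the one-dimensional $\mathcal W_+$-module on which $x\in\mathcal W_+$ acts by $\varphi(x)$, and, for $\xi\in\mathbb C$, let $L_{\varphi,\xi}=M_\varphi/(z-\xi)M_\varphi$. Let $V$ be a Whittaker $\mathcal W$-module of type $\varphi$ with cyclic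 Whittaker vector $w$, i.e. $xw=\varphi(x)w$ for all $x\in\mathcal W_+$ and $U(\mathcal W)w=V$. Suppose that $\mathrm{Ann}_{S(z)}(w)=\{p\in S(z)\mid p\,w=0\}$ is the ideal of $S(z)$ generated by $(z-\xi)^a$ for some $\xi\in\mathbb C$ and some integer $a>0$. Put $V_i=U(\mathcal W)(z-\xi)^iw$ for $0\le i\le a$. Then: 1) $V=V_0\supsetneq V_1\supsetneq\cdots\supsetneq V_a=0$ is a composition series of $V$ (every factor $V_i/V_{i+1}$, $0\le i<a$, is a simple $\mathcal W$-module), and $V_i/V_{i+1}\cong L_{\varphi,\xi}$ for all $0\le i<a$; 2) $V_0,\dots,V_a$ are all the submodules of $V$. -/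

import Mathlib

open scoped TensorProduct

attribute [local instance 100] LieRing.ofAssociativeRing

/-! ### The Lie algebra `W(2,2)` -/

/-- Labels of the basis `{L n, W n, z | n ∈ ℤ}`. -/
inductive W22Index : Type
  | L (n : ℤ)
  | W (n : ℤ)
  | z

/-- The underlying complex vector space of `W(2,2)`, with basis labelled by `W22Index`. -/
def W22 : Type := W22Index →₀ ℂ

namespace W22

noncomputable section

instance : AddCommGroup W22 := inferInstanceAs (AddCommGroup (W22Index →₀ ℂ))

instance : Module ℂ W22 := inferInstanceAs (Module ℂ (W22Index →₀ ℂ))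

/-- The standard basis, consisting of all `L n`, all `W n` and `z`. -/
def basis : Module.Basis W22Index ℂ W22 := ⟨LinearEquiv.refl ℂ (W22Index →₀ ℂ)⟩

/-- The basis vector `L n`. -/
def L (n : ℤ) : W22 := basis (W22Index.L n)

/-- The basis vector `W n`. -/
def W (n : ℤ) : W22 := basis (W22Index.W n)

/-- The basis vector `z`. -/
def z : W22 := basis W22Index.z

/-- The central term `(n ^ 3 - n) / 12 * δ_{m + n, 0} z`. -/
def central (n m : ℤ) : W22 := if m + n = 0 then (((n : ℂ) ^ 3 - n) / 12) • z else 0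

/-- The bracket of two basis vectors. -/
def basisBracket : W22Index → W22Index → W22
  | .L n, .L m => ((m : ℂ) - n) • L (m + n) + central n m
  | .L n, .W m => ((m : ℂ) - n) • W (m + n) + central n m
  | .W n, .L m => -(((n : ℂ) - m) • W (n + m) + central m n)
  | .W _, .W _ => 0
  | .z, _ => 0
  | _, .z => 0

/-- The bilinear extension of `basisBracket`. -/
def bracketMap : W22 →ₗ[ℂ] W22 →ₗ[ℂ] W22 :=
  basis.constr ℂ fun i => basis.constr ℂ (basisBracket i)

instance : Bracket W22 W22 := ⟨fun x y => bracketMap x y⟩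

theorem lie_def (x y : W22) : ⁅x, y⁆ = bracketMap x y := rfl

theorem bracketMap_basis (i j : W22Index) :
    bracketMap (basis i) (basis j) = basisBracket i j := by
  simp only [bracketMap, Module.Basis.constr_basis]

theorem central_skew (n m : ℤ) : central n m = -central m n := by
  unfold central
  by_cases h : m + n = 0
  · have h' : n + m = 0 := by omega
    have e : m = -n := by omega
    rw [if_pos h, if_pos h', ← neg_smul]
    congr 1
    rw [e]; push_cast; ring
  · have h' : ¬ n + m = 0 := by omega
    rw [if_neg h, if_neg h', neg_zero]

theorem basisBracket_skew (i j : W22Index) : basisBracket i j = -basisBracket j i := by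
  rcases i with n | n | _ <;> rcases j with m | m | _ <;> simp only [basisBracket, neg_neg, neg_zero]
  rw [central_skew n m, add_comm m n, neg_add, ← neg_smul]
  congr 2
  ring

theorem bracketMap_skew (x y : W22) : bracketMap x y = -bracketMap y x := by
  have h : bracketMap = -bracketMap.flip := basis.ext fun i => basis.ext fun j => by
    simp only [LinearMap.neg_apply, LinearMap.flip_apply, bracketMap_basis]
    exact basisBracket_skew i j
  exact LinearMap.congr_fun (LinearMap.congr_fun h x) y

theorem bracketMap_z (x : W22) : bracketMap x z = 0 := by
  have h : bracketMap.flip z = 0 := basis.ext fun i => by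
    simp only [LinearMap.flip_apply, z, bracketMap_basis, LinearMap.zero_apply]
    rcases i with n | n | _ <;> rfl
  exact LinearMap.congr_fun h x

theorem z_bracketMap (x : W22) : bracketMap z x = 0 := by
  rw [bracketMap_skew, bracketMap_z, neg_zero]

theorem bracketMap_central (x : W22) (n m : ℤ) : bracketMap x (central n m) = 0 := by
  unfold central
  split_ifs
  · rw [map_smul, bracketMap_z, smul_zero]
  · exact map_zero _

theorem central_bracketMap (x : W22) (n m : ℤ) : bracketMap (central n m) x = 0 := by
  rw [bracketMap_skew, bracketMap_central, neg_zero]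

theorem bracketMap_L_L (n m : ℤ) :
    bracketMap (L n) (L m) = ((m : ℂ) - n) • L (m + n) + central n m := bracketMap_basis _ _

theorem bracketMap_L_W (n m : ℤ) :
    bracketMap (L n) (W m) = ((m : ℂ) - n) • W (m + n) + central n m := bracketMap_basis _ _

theorem bracketMap_W_L (n m : ℤ) :
    bracketMap (W n) (L m) = -(((n : ℂ) - m) • W (n + m) + central m n) := bracketMap_basis _ _

theorem bracketMap_W_W (n m : ℤ) : bracketMap (W n) (W m) = 0 := bracketMap_basis _ _

theorem central_of_eq {n m : ℤ} (h : m + n = 0) :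
    central n m = (((n : ℂ) ^ 3 - n) / 12) • z := if_pos h

theorem central_of_ne {n m : ℤ} (h : m + n ≠ 0) : central n m = 0 := if_neg h

theorem jacobi_basis (i j k : W22Index) :
    bracketMap (basis i) (bracketMap (basis j) (basis k))
      = bracketMap (bracketMap (basis i) (basis j)) (basis k)
        + bracketMap (basis j) (bracketMap (basis i) (basis k)) := by
  have hL (n : ℤ) : basis (W22Index.L n) = L n := rfl
  have hW (n : ℤ) : basis (W22Index.W n) = W n := rfl
  have hz : basis W22Index.z = z := rfl
  rcases i with n | n | _ <;> rcases j with m | m | _ <;> rcases k with k | k | _ <;>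
    simp only [hL, hW, hz, bracketMap_z, z_bracketMap, map_zero, LinearMap.zero_apply, add_zero,
      bracketMap_L_L, bracketMap_L_W, bracketMap_W_L, bracketMap_W_W, map_add, map_neg, map_smul,
      LinearMap.add_apply, LinearMap.neg_apply, LinearMap.smul_apply, bracketMap_central,
      central_bracketMap, smul_zero, neg_zero]
  · rw [show k + (m + n) = k + m + n by ring, show k + n + m = k + m + n by ring]
    by_cases h : k + m + n = 0
    · obtain rfl : k = -(m + n) := by omega
      rw [central_of_eq (n := n) (m := (-(m + n)) + m) (by omega), central_of_eq (n := m + n) (m := -(m + n)) (by omega), central_of_eq (n := m) (m := (-(m + n)) + n) (by omega)]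
      push_cast
      module
    · rw [central_of_ne (n := n) (m := k + m) (by omega), central_of_ne (n := m + n) (m := k) (by omega), central_of_ne (n := m) (m := k + n) (by omega)]
      push_cast
      module
  · rw [show k + (m + n) = k + m + n by ring, show k + n + m = k + m + n by ring]
    by_cases h : k + m + n = 0
    · obtain rfl : k = -(m + n) := by omega
      rw [central_of_eq (n := n) (m := (-(m + n)) + m) (by omega), central_of_eq (n := m + n) (m := -(m + n)) (by omega), central_of_eq (n := m) (m := (-(m + n)) + n) (by omega)]
      push_cast
      module
    · rw [central_of_ne (n := n) (m := k + m) (by omega), central_of_ne (n := m + n) (m := k) (by omega), central_of_ne (n := m) (m := k + n) (by omega)]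
      push_cast
      module
  · rw [show m + k + n = k + m + n by ring, show m + n + k = k + m + n by ring, show m + (k + n) = k + m + n by ring]
    by_cases h : k + m + n = 0
    · obtain rfl : k = -(m + n) := by omega
      rw [central_of_eq (n := n) (m := m + (-(m + n))) (by omega), central_of_eq (n := -(m + n)) (m := m + n) (by omega), central_of_eq (n := -(m + n) + n) (m := m) (by omega)]
      push_cast
      module
    · rw [central_of_ne (n := n) (m := m + k) (by omega), central_of_ne (n := k) (m := m + n) (by omega), central_of_ne (n := k + n) (m := m) (by omega)]
      push_cast
      module
  · rw [show n + (k + m) = k + m + n by ring, show n + m + k = k + m + n by ring, show n + k + m = k + m + n by ring]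
    by_cases h : k + m + n = 0
    · obtain rfl : k = -(m + n) := by omega
      rw [central_of_eq (n := -(m + n) + m) (m := n) (by omega), central_of_eq (n := -(m + n)) (m := n + m) (by omega), central_of_eq (n := m) (m := n + (-(m + n))) (by omega)]
      push_cast
      module
    · rw [central_of_ne (n := k + m) (m := n) (by omega), central_of_ne (n := k) (m := n + m) (by omega), central_of_ne (n := m) (m := n + k) (by omega)]
      push_cast
      module

theorem jacobi (x y w : W22) :
    bracketMap x (bracketMap y w)
      = bracketMap (bracketMap x y) w + bracketMap y (bracketMap x w) := by
  have h1 (i j : W22Index) : bracketMap (basis i) ∘ₗ bracketMap (basis j)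
      = bracketMap (bracketMap (basis i) (basis j))
        + bracketMap (basis j) ∘ₗ bracketMap (basis i) :=
    basis.ext fun k => jacobi_basis i j k
  have h2 (i : W22Index) : bracketMap (basis i) (bracketMap y w)
      = bracketMap (bracketMap (basis i) y) w + bracketMap y (bracketMap (basis i) w) := by
    have h : bracketMap (basis i) ∘ₗ bracketMap.flip w
        = bracketMap.flip w ∘ₗ bracketMap (basis i)
          + bracketMap.flip (bracketMap (basis i) w) :=
      basis.ext fun j => LinearMap.congr_fun (h1 i j) w
    exact LinearMap.congr_fun h y
  have h : bracketMap.flip (bracketMap y w)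
      = bracketMap.flip w ∘ₗ bracketMap.flip y + bracketMap y ∘ₗ bracketMap.flip w :=
    basis.ext fun i => h2 i
  exact LinearMap.congr_fun h x

instance : LieRing W22 where
  add_lie x y w := by simp only [lie_def, map_add, LinearMap.add_apply]
  lie_add x y w := by simp only [lie_def, map_add]
  lie_self x := by
    have h : (2 : ℂ) • bracketMap x x = 0 := by
      rw [two_smul]
      nth_rewrite 1 [bracketMap_skew x x]
      exact neg_add_cancel _
    exact (smul_eq_zero.mp h).resolve_left two_ne_zero
  leibniz_lie x y w := jacobi x y w

instance : LieAlgebra ℂ W22 where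
  lie_smul c x y := by simp only [lie_def, map_smul]

end

end W22

/-! ### The subalgebra `W₊`, non-singular characters, and the action of `U(W(2,2))` -/

namespace W22

noncomputable section

/-- The basis vectors `L n`, `W n` with `n > 0`. -/
def positiveVectors : Set W22 := {x | ∃ n : ℤ, 0 < n ∧ (x = L n ∨ x = W n)}

theorem lie_mem_span_positiveVectors {x y : W22} (hx : x ∈ Submodule.span ℂ positiveVectors)
    (hy : y ∈ Submodule.span ℂ positiveVectors) :
    ⁅x, y⁆ ∈ Submodule.span ℂ positiveVectors := by
  induction hx, hy using Submodule.span_induction₂ with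
  | mem_mem x y hx hy =>
    obtain ⟨n, hn, hx⟩ := hx
    obtain ⟨m, hm, hy⟩ := hy
    have hL {k : ℤ} (hk : 0 < k) : L k ∈ Submodule.span ℂ positiveVectors :=
      Submodule.subset_span ⟨k, hk, Or.inl rfl⟩
    have hW {k : ℤ} (hk : 0 < k) : W k ∈ Submodule.span ℂ positiveVectors :=
      Submodule.subset_span ⟨k, hk, Or.inr rfl⟩
    rw [lie_def]
    rcases hx with rfl | rfl <;> rcases hy with rfl | rfl
    · rw [bracketMap_L_L, central_of_ne (by omega), add_zero]
      exact Submodule.smul_mem _ _ (hL (by omega))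
    · rw [bracketMap_L_W, central_of_ne (by omega), add_zero]
      exact Submodule.smul_mem _ _ (hW (by omega))
    · rw [bracketMap_W_L, central_of_ne (by omega), add_zero]
      exact Submodule.neg_mem _ (Submodule.smul_mem _ _ (hW (by omega)))
    · rw [bracketMap_W_W]
      exact Submodule.zero_mem _
  | zero_left y hy => rw [zero_lie]; exact Submodule.zero_mem _
  | zero_right x hx => rw [lie_zero]; exact Submodule.zero_mem _
  | add_left x x' y _ _ _ h h' => rw [add_lie]; exact Submodule.add_mem _ h h'
  | add_right x y y' _ _ _ h h' => rw [lie_add]; exact Submodule.add_mem _ h h'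
  | smul_left c x y _ _ h => rw [smul_lie]; exact Submodule.smul_mem _ _ h
  | smul_right c x y _ _ h => rw [lie_smul]; exact Submodule.smul_mem _ _ h

/-- The subalgebra `W₊` spanned by all `L n` and `W n` with `n > 0`. -/
def plus : LieSubalgebra ℂ W22 :=
  { Submodule.span ℂ positiveVectors with lie_mem' := lie_mem_span_positiveVectors }

/-- `L n` as an element of `W₊`. -/
def plusL (n : ℤ) (hn : 0 < n) : plus := ⟨L n, Submodule.subset_span ⟨n, hn, Or.inl rfl⟩⟩

/-- `W n` as an element of `W₊`. -/
def plusW (n : ℤ) (hn : 0 < n) : plus := ⟨W n, Submodule.subset_span ⟨n, hn, Or.inr rfl⟩⟩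

/-- A Lie algebra homomorphism `φ : W₊ → ℂ` is non-singular if
`φ (L i) φ (W i) ≠ 0` for `i = 1, 2`. -/
def IsNonsingular (φ : plus →ₗ⁅ℂ⁆ ℂ) : Prop :=
  φ (plusL 1 one_pos) * φ (plusW 1 one_pos) ≠ 0 ∧ φ (plusL 2 two_pos) * φ (plusW 2 two_pos) ≠ 0

/-- The universal enveloping algebra of `W(2,2)`. -/
abbrev U : Type := UniversalEnvelopingAlgebra ℂ W22

/-- The universal enveloping algebra of `W₊`. -/
abbrev UPlus : Type := UniversalEnvelopingAlgebra ℂ plus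

/-- The canonical map `W(2,2) → U(W(2,2))`. -/
abbrev toU : W22 →ₗ⁅ℂ⁆ U := UniversalEnvelopingAlgebra.ι ℂ

/-- The canonical map `U(W₊) → U(W(2,2))`. -/
def uPlusToU : UPlus →ₐ[ℂ] U := UniversalEnvelopingAlgebra.lift ℂ (toU.comp plus.incl)

section Modules

variable (V : Type*) [AddCommGroup V] [Module ℂ V] [LieRingModule W22 V] [LieModule ℂ W22 V]

/-- The action of `U(W(2,2))` on a `W(2,2)`-module. -/
def uAction : U →ₐ[ℂ] Module.End ℂ V :=
  UniversalEnvelopingAlgebra.lift ℂ (LieModule.toEnd ℂ W22 V)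

variable {V}

/-- The submodule `U(W(2,2)) v`. -/
def cyclicSubmodule (v : V) : LieSubmodule ℂ W22 V where
  toSubmodule := LinearMap.range ((uAction V).toLinearMap.flip v)
  lie_mem := by
    rintro x _ ⟨u, rfl⟩
    refine ⟨toU x * u, ?_⟩
    simp [uAction]

/-- A Whittaker vector of type `φ`. -/
def IsWhittakerVector (φ : plus →ₗ⁅ℂ⁆ ℂ) (v : V) : Prop :=
  ∀ x : plus, ⁅(x : W22), v⁆ = φ x • v

/-- `V` is a Whittaker module of type `φ` with cyclic Whittaker vector `w`. -/
structure IsCyclicWhittakerVector (φ : plus →ₗ⁅ℂ⁆ ℂ) (w : V) : Prop where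
  nonsingular : IsNonsingular φ
  isWhittakerVector : IsWhittakerVector φ w
  cyclic : cyclicSubmodule w = ⊤

/-- The annihilator of `v` in the algebra `S(z) = ℂ[z]`. -/
def annSz (v : V) : Ideal (Polynomial ℂ) where
  carrier := {p | uAction V (Polynomial.aeval (toU z) p) v = 0}
  add_mem' {p q} hp hq := by
    simp only [Set.mem_ofPred_eq] at hp hq ⊢
    rw [map_add, map_add, LinearMap.add_apply, hp, hq, add_zero]
  zero_mem' := by simp
  smul_mem' p q hq := by
    simp only [Set.mem_ofPred_eq] at hq ⊢
    rw [smul_eq_mul, map_mul, map_mul, Module.End.mul_apply, hq, map_zero]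

variable (V)

/-- The submodule `(z - ξ) V`. -/
def zSubRange (ξ : ℂ) : LieSubmodule ℂ W22 V where
  toSubmodule := LinearMap.range (uAction V (toU z - algebraMap ℂ U ξ))
  lie_mem := by
    rintro x _ ⟨v, rfl⟩
    refine ⟨⁅x, v⁆, ?_⟩
    have h : ⁅x, z⁆ = 0 := by rw [lie_def, bracketMap_z]
    have h' : ⁅x, ⁅z, v⁆⁆ = ⁅z, ⁅x, v⁆⁆ := by rw [leibniz_lie, h, zero_lie, zero_add]
    simp [uAction, h']

end Modules

/-! ### The universal Whittaker module and its quotients -/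

/-- The elements `u n ⊗ α - u ⊗ φ(n) α` of `U(W(2,2)) ⊗_ℂ ℂ`, for `u` in `U(W(2,2))`,
`n` in `U(W₊)` and `α` in `ℂ`. -/
def balancingRelations (φ : plus →ₗ⁅ℂ⁆ ℂ) : Set (U ⊗[ℂ] ℂ) :=
  {t | ∃ (u : U) (n : UPlus) (α : ℂ),
    t = (u * uPlusToU n) ⊗ₜ[ℂ] α - u ⊗ₜ[ℂ] (UniversalEnvelopingAlgebra.lift ℂ φ n * α)}

/-- The universal Whittaker module `M_φ = U(W(2,2)) ⊗_{U(W₊)} ℂ_φ`, as a left `U(W(2,2))`-module: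
the tensor product over `ℂ` modulo the balancing relations over `U(W₊)`. -/
def universalModule (φ : plus →ₗ⁅ℂ⁆ ℂ) : Type :=
  (U ⊗[ℂ] ℂ) ⧸ Submodule.span U (balancingRelations φ)

section Universal

variable (φ : plus →ₗ⁅ℂ⁆ ℂ)

instance : AddCommGroup (universalModule φ) :=
  inferInstanceAs (AddCommGroup ((U ⊗[ℂ] ℂ) ⧸ Submodule.span U (balancingRelations φ)))

instance : Module U (universalModule φ) :=
  inferInstanceAs (Module U ((U ⊗[ℂ] ℂ) ⧸ Submodule.span U (balancingRelations φ)))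

instance : Module ℂ (universalModule φ) :=
  inferInstanceAs (Module ℂ ((U ⊗[ℂ] ℂ) ⧸ Submodule.span U (balancingRelations φ)))

instance : IsScalarTower ℂ U (universalModule φ) :=
  inferInstanceAs (IsScalarTower ℂ U ((U ⊗[ℂ] ℂ) ⧸ Submodule.span U (balancingRelations φ)))

/-- `W(2,2)` acts on `M_φ` through its enveloping algebra. -/
instance : LieRingModule W22 (universalModule φ) where
  bracket x m := toU x • m
  add_lie x y m := by
    change toU (x + y) • m = toU x • m + toU y • m
    rw [map_add, add_smul]
  lie_add x m n := smul_add _ _ _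
  leibniz_lie x y m := by
    change toU x • toU y • m = toU ⁅x, y⁆ • m + toU y • toU x • m
    rw [LieHom.map_lie, LieRing.of_associative_ring_bracket, sub_smul, mul_smul, mul_smul,
      sub_add_cancel]

instance : LieModule ℂ W22 (universalModule φ) where
  smul_lie c x m := by
    change toU (c • x) • m = c • toU x • m
    rw [map_smul, smul_assoc]
  lie_smul c x m := by
    change toU x • c • m = c • toU x • m
    rw [← algebraMap_smul U c m, ← algebraMap_smul U c (toU x • m), ← mul_smul, ← mul_smul,
      Algebra.commutes]

/-- The module `L_{φ,ξ} = M_φ / (z - ξ) M_φ`. -/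
abbrev simpleQuotient (ξ : ℂ) : Type :=
  universalModule φ ⧸ zSubRange (universalModule φ) ξ

end Universal

section Factors

variable {V : Type*} [AddCommGroup V] [Module ℂ V] [LieRingModule W22 V] [LieModule ℂ W22 V]

/-- The factor `N / N'` of two submodules `N' ≤ N`. -/
abbrev factor (N N' : LieSubmodule ℂ W22 V) : Type _ := N ⧸ N'.comap N.incl

/-- The submodule `V_i = U(W(2,2)) (z - ξ) ^ i w`. -/
def seriesSubmodule (w : V) (ξ : ℂ) (i : ℕ) : LieSubmodule ℂ W22 V :=
  cyclicSubmodule (uAction V ((toU z - algebraMap ℂ U ξ) ^ i) w)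

end Factors

end

end W22

/-! ### Number operators: a substitute for a basis. -/

section LadderOperators

variable {V : Type*} [AddCommGroup V] [Module ℂ V]

/-! The core is a simplicity criterion: a module generated by a nonzero Whittaker vector `w` of
non-singular type, on which `z` acts by a scalar, is simple (`IsWhittakerVector.isIrreducible`).
Since `φ` kills brackets, `φ (W n) = 0` for `n ≥ 3`, while `φ (W 2) ≠ 0`. The module is spanned by
products of `L (-k)` times products of `W (-k)` applied to `w`, with `k ≥ 0`. Modulo terms with
fewer factors `L`, the operator `W (K + 2) - φ (W (K + 2))` kills the products whose indices are all
`< K` and has a nonzero scalar commutator with `L (-K)`, coming from `W 2`: it acts like a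
derivative in `L (-K)`. Applying such operators to a nonzero vector of a submodule removes all
factors `L` without producing zero. On the remaining polynomials in the `W (-k)`, the operators `L
(K + 2) - φ (L (K + 2))` are derivatives in `W (-K)` in the same way and lead down to a nonzero
multiple of `w`.

"Zero derivative implies independence of the variable" would be immediate from a PBW basis, but no
linear independence is available in an arbitrary quotient. `mem_of_mem_ladderSpan` replaces it: if
`[D, A] = c`, then `c⁻¹ A D` counts the factors `A`, and a polynomial in this operator separates the
degrees.

The criterion applies to each `V_i / V_{i+1}`, generated by the class of `(z - ξ) ^ i w`, and to
`L_{φ,ξ}`; the universal property of `M_φ` then identifies the two. The submodules are found by a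
Nakayama-type descent using that `z - ξ` is nilpotent on `V` (`eq_seriesSubmodule`). -/

/-- The product `(T - 1) (T - 2) ⋯ (T - n)`. -/
def shiftedProd (T : Module.End ℂ V) : ℕ → Module.End ℂ V
  | 0 => 1
  | n + 1 => (T - algebraMap ℂ _ ((n : ℂ) + 1)) * shiftedProd T n

theorem shiftedProd_succ_apply (T : Module.End ℂ V) (n : ℕ) (v : V) :
    shiftedProd T (n + 1) v = T (shiftedProd T n v) - ((n : ℂ) + 1) • shiftedProd T n v := by
  simp only [shiftedProd, Module.End.mul_apply, LinearMap.sub_apply, Module.algebraMap_end_apply]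

theorem shiftedProd_mem {T : Module.End ℂ V} {S : Submodule ℂ V} (hS : ∀ v ∈ S, T v ∈ S) (n : ℕ)
    {v : V} (hv : v ∈ S) : shiftedProd T n v ∈ S := by
  induction n with
  | zero => exact hv
  | succ n ih =>
    rw [shiftedProd_succ_apply]
    exact S.sub_mem (hS _ ih) (S.smul_mem _ ih)

/-- If `T A ≡ A (T + 1)`, then `(T - 1) ⋯ (T - n - 1) A ≡ A T (T - 1) ⋯ (T - n)`. -/
theorem shiftedProd_apply_ladder {A T : Module.End ℂ V} {G Z : Submodule ℂ V}
    (hG : ∀ v ∈ G, T v ∈ G) (hZ : ∀ v ∈ Z, T v ∈ Z)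
    (hA : ∀ v ∈ G, T (A v) - A (T v) - A v ∈ Z) (n : ℕ) {v : V} (hv : v ∈ G) :
    shiftedProd T (n + 1) (A v) - A (T (shiftedProd T n v)) ∈ Z := by
  induction n with
  | zero =>
    rw [shiftedProd_succ_apply]
    simpa [shiftedProd, sub_right_comm] using hA v hv
  | succ n ih =>
    set y := shiftedProd T n v with hy
    have hyG : y ∈ G := shiftedProd_mem hG n hv
    rw [shiftedProd_succ_apply T (n + 1) (A v), shiftedProd_succ_apply T n v, ← hy]
    have h1 := hA (T y) (hG _ hyG)
    have h2 := Z.sub_mem (hZ _ ih) (Z.smul_mem (((n + 1 : ℕ) : ℂ) + 1) ih)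
    have := Z.add_mem h1 h2
    convert this using 1
    simp only [map_sub, map_smul]
    push_cast
    module

/-- Modulo `Z` the factor `T - j` multiplies `v` by `-j`, so the scalar is `(-1) ^ n * n!`, which is
nonzero in characteristic zero. -/
theorem shiftedProd_apply_of_mem {T : Module.End ℂ V} {Z : Submodule ℂ V}
    (hZ : ∀ v ∈ Z, T v ∈ Z) {v : V} (hv : T v ∈ Z) (n : ℕ) :
    ∃ s : ℂ, s ≠ 0 ∧ shiftedProd T n v - s • v ∈ Z := by
  induction n with
  | zero => exact ⟨1, one_ne_zero, by simp [shiftedProd]⟩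
  | succ n ih =>
    obtain ⟨s, hs, h⟩ := ih
    refine ⟨-((n : ℂ) + 1) * s, mul_ne_zero (neg_ne_zero.mpr (Nat.cast_add_one_ne_zero n)) hs, ?_⟩
    rw [shiftedProd_succ_apply]
    have := Z.add_mem (Z.sub_mem (hZ _ h) (Z.smul_mem ((n : ℂ) + 1) h)) (Z.smul_mem s hv)
    convert this using 1
    simp only [map_sub, map_smul]
    module

/-- The filtered space generated by applying the operator `A` to the filtered space `H`. -/
def ladderSpan (A : Module.End ℂ V) (H : ℕ → Submodule ℂ V) : ℕ → Submodule ℂ V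
  | 0 => H 0
  | d + 1 => H (d + 1) ⊔ (ladderSpan A H d).map A

theorem le_ladderSpan (A : Module.End ℂ V) (H : ℕ → Submodule ℂ V) (d : ℕ) :
    H d ≤ ladderSpan A H d := by
  cases d with
  | zero => exact le_rfl
  | succ d => exact le_sup_left

theorem apply_mem_ladderSpan {A : Module.End ℂ V} {H : ℕ → Submodule ℂ V} {d : ℕ} {v : V}
    (hv : v ∈ ladderSpan A H d) : A v ∈ ladderSpan A H (d + 1) :=
  Submodule.mem_sup_right (Submodule.mem_map_of_mem hv)

/-- Suppose that, modulo `Z`, the operators `A` and `D` satisfy `[D, A] = c ≠ 0` and that `D` kills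
`H`. Then a vector killed by `D` in the space generated from `H` by `A` is in `H`. -/
theorem mem_of_mem_ladderSpan {A D : Module.End ℂ V} {c : ℂ} (hc : c ≠ 0)
    {Z H : ℕ → Submodule ℂ V} (hZH : ∀ d, Z d ≤ H d)
    (hHZ : ∀ d, ∀ v ∈ H d, A (D v) ∈ Z d) (hAZ : ∀ d, ∀ v ∈ Z d, A v ∈ Z (d + 1))
    (hcomm : ∀ d, ∀ v ∈ ladderSpan A H d, A (D (A v) - A (D v) - c • v) ∈ Z (d + 1))
    {d : ℕ} {v : V} (hv : v ∈ ladderSpan A H d) (hDv : A (D v) ∈ Z d) : v ∈ H d := by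
  have hGG (d : ℕ) : ∀ v ∈ ladderSpan A H d, A (D v) ∈ ladderSpan A H d := by
    induction d with
    | zero => exact fun v hv => hZH 0 (hHZ 0 v hv)
    | succ d ih =>
      intro v hv
      obtain ⟨u, hu, _, ⟨y, hy, rfl⟩, rfl⟩ := Submodule.mem_sup.mp hv
      rw [map_add, map_add]
      refine Submodule.add_mem _ (le_ladderSpan A H _ (hZH _ (hHZ _ _ hu))) ?_
      have h1 := le_ladderSpan A H _ (hZH _ (hcomm d y hy))
      -- Up to an element of `Z`, `A D A y = A (A D y + c y)`, and the inner vector is in the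
      -- previous step.
      have h2 := apply_mem_ladderSpan
        (Submodule.add_mem _ (ih y hy) (Submodule.smul_mem _ c hy))
      have h3 := Submodule.add_mem _ h1 h2
      simpa only [map_sub, map_add, sub_sub, sub_add_cancel] using h3
  -- The number operator: modulo `Z`, it acts on `A ^ k h` with `h` in `H` as multiplication by `k`.
  let T : Module.End ℂ V := c⁻¹ • (A * D)
  have hT (u : V) : T u = c⁻¹ • A (D u) := rfl
  have hTZ (d : ℕ) : ∀ v ∈ H d, T v ∈ Z d := fun v hv => (Z d).smul_mem _ (hHZ d v hv)
  have hTH (d : ℕ) : ∀ v ∈ H d, T v ∈ H d := fun v hv => hZH d (hTZ d v hv)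
  have hTZZ (d : ℕ) : ∀ v ∈ Z d, T v ∈ Z d := fun v hv => hTZ d v (hZH d hv)
  have hTG (d : ℕ) : ∀ v ∈ ladderSpan A H d, T v ∈ ladderSpan A H d :=
    fun v hv => (ladderSpan A H d).smul_mem _ (hGG d v hv)
  -- The roots `1, …, d` remove every component with a positive number of factors `A`; what survives
  -- comes from `H`.
  have key (d : ℕ) : ∀ v ∈ ladderSpan A H d, shiftedProd T d v ∈ H d := by
    induction d with
    | zero => exact fun v hv => hv
    | succ d ih =>
      intro v hv
      obtain ⟨u, hu, _, ⟨y, hy, rfl⟩, rfl⟩ := Submodule.mem_sup.mp hv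
      rw [map_add]
      refine (H _).add_mem (shiftedProd_mem (hTH _) _ hu) ?_
      have h1 := shiftedProd_apply_ladder (A := A) (hTG d) (hTZZ (d + 1)) (fun v hv => by
        have := (Z (d + 1)).smul_mem c⁻¹ (hcomm d v hv)
        convert this using 1
        simp only [hT, map_sub, map_smul, smul_sub, inv_smul_smul₀ hc]) d hy
      have h2 := hAZ d _ (hTZ d _ (ih y hy))
      exact hZH _ (by simpa using (Z (d + 1)).add_mem h1 h2)
  -- Since `T v` vanishes modulo `Z`, the same product is also a nonzero multiple of `v`; comparison
  -- with `key` puts `v` in `H d`.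
  obtain ⟨s, hs, h⟩ := shiftedProd_apply_of_mem (hTZZ d) ((Z d).smul_mem c⁻¹ hDv : T v ∈ Z d) d
  have h3 := (H d).sub_mem (key d v hv) (hZH d h)
  rw [sub_sub_cancel] at h3
  exact ((H d).smul_mem_iff hs).mp h3

theorem ladderSpan_const_mono (A : Module.End ℂ V) (H : Submodule ℂ V) :
    Monotone (ladderSpan A fun _ => H) := by
  refine monotone_nat_of_le_succ fun d => ?_
  induction d with
  | zero => exact le_sup_left
  | succ d ih => exact sup_le_sup le_rfl (Submodule.map_mono ih)

end LadderOperators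

/-! ### Commutation relations on a module with scalar `z`. -/

namespace W22

theorem lie_W_W {V : Type*} [AddCommGroup V] [LieRingModule W22 V] (n m : ℤ) (v : V) :
    ⁅W n, ⁅W m, v⁆⁆ = ⁅W m, ⁅W n, v⁆⁆ := by
  rw [leibniz_lie, lie_def, bracketMap_W_W, zero_lie, zero_add]

section Action

variable {V : Type*} [AddCommGroup V] [Module ℂ V] [LieRingModule W22 V] [LieModule ℂ W22 V]

/-- `w` is an eigenvector of all `L n` and `W n` with `n > 0`, in a module on which `z` acts
by `ξ`. -/
structure IsEigenvector (lam psi : ℤ → ℂ) (ξ : ℂ) (w : V) : Prop where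
  lie_L : ∀ n : ℤ, 0 < n → ⁅L n, w⁆ = lam n • w
  lie_W : ∀ n : ℤ, 0 < n → ⁅W n, w⁆ = psi n • w
  lie_z : ∀ v : V, ⁅z, v⁆ = ξ • v

variable {lam psi : ℤ → ℂ} {ξ : ℂ} {w : V}

theorem IsEigenvector.lie_central (h : IsEigenvector lam psi ξ w) (n m : ℤ) :
    ∃ s : ℂ, (m + n ≠ 0 → s = 0) ∧ ∀ v : V, ⁅central n m, v⁆ = s • v := by
  by_cases hnm : m + n = 0
  · refine ⟨((n : ℂ) ^ 3 - n) / 12 * ξ, fun h' => absurd hnm h', fun v => ?_⟩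
    rw [central_of_eq hnm, smul_lie, h.lie_z, smul_smul]
  · exact ⟨0, fun _ => rfl, fun v => by rw [central_of_ne hnm, zero_lie, zero_smul]⟩

theorem IsEigenvector.lie_L_L (h : IsEigenvector lam psi ξ w) (n m : ℤ) :
    ∃ s : ℂ, (m + n ≠ 0 → s = 0) ∧ ∀ v : V,
      ⁅L n, ⁅L m, v⁆⁆ = ⁅L m, ⁅L n, v⁆⁆ + ((m : ℂ) - n) • ⁅L (m + n), v⁆ + s • v := by
  obtain ⟨s, hs, hv⟩ := h.lie_central n m
  refine ⟨s, hs, fun v => ?_⟩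
  rw [leibniz_lie, lie_def, bracketMap_L_L, add_lie, smul_lie, hv]
  abel

theorem IsEigenvector.lie_L_W (h : IsEigenvector lam psi ξ w) (n m : ℤ) :
    ∃ s : ℂ, (m + n ≠ 0 → s = 0) ∧ ∀ v : V,
      ⁅L n, ⁅W m, v⁆⁆ = ⁅W m, ⁅L n, v⁆⁆ + ((m : ℂ) - n) • ⁅W (m + n), v⁆ + s • v := by
  obtain ⟨s, hs, hv⟩ := h.lie_central n m
  refine ⟨s, hs, fun v => ?_⟩
  rw [leibniz_lie, lie_def, bracketMap_L_W, add_lie, smul_lie, hv]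
  abel

theorem IsEigenvector.lie_W_L (h : IsEigenvector lam psi ξ w) (n m : ℤ) :
    ∃ s : ℂ, (m + n ≠ 0 → s = 0) ∧ ∀ v : V,
      ⁅W n, ⁅L m, v⁆⁆ = ⁅L m, ⁅W n, v⁆⁆ + ((m : ℂ) - n) • ⁅W (n + m), v⁆ + s • v := by
  obtain ⟨s, hs, hv⟩ := h.lie_L_W m n
  refine ⟨-s, fun h => by rw [hs (by omega), neg_zero], fun v => ?_⟩
  rw [hv]
  module

/-! ### Polynomials in the `W (-k)` applied to the cyclic vector -/

/-- The span of the vectors `W (-k₁) ⋯ W (-kᵣ) w` with `k₁, …, kᵣ ≥ 0`. -/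
def polyW (w : V) : Submodule ℂ V :=
  Submodule.span ℂ (Set.range fun l : List ℕ =>
    (l.map fun k => LieModule.toEnd ℂ W22 V (W (-(k : ℤ)))).prod w)

theorem self_mem_polyW (w : V) : w ∈ polyW w := Submodule.subset_span ⟨[], rfl⟩

theorem lie_W_neg_mem_polyW (k : ℕ) {v : V} (hv : v ∈ polyW w) :
    ⁅W (-(k : ℤ)), v⁆ ∈ polyW w := by
  have : polyW w ≤ (polyW w).comap (LieModule.toEnd ℂ W22 V (W (-(k : ℤ)))) := by
    refine Submodule.span_le.mpr ?_
    rintro _ ⟨l, rfl⟩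
    exact Submodule.subset_span ⟨k :: l, by simp⟩
  exact this hv

theorem polyW_le {S : Submodule ℂ V} (hw : w ∈ S)
    (hS : ∀ k : ℕ, ∀ v ∈ S, ⁅W (-(k : ℤ)), v⁆ ∈ S) : polyW w ≤ S := by
  refine Submodule.span_le.mpr ?_
  rintro _ ⟨l, rfl⟩
  induction l with
  | nil => exact hw
  | cons k l ih =>
    exact hS k _ ih

/-- All `W n` commute, so the eigenvalue on `w` carries over to every product of them applied to
`w`. -/
theorem IsEigenvector.lie_W_polyW (h : IsEigenvector lam psi ξ w) {n : ℤ} (hn : 0 < n) {v : V}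
    (hv : v ∈ polyW w) : ⁅W n, v⁆ = psi n • v := by
  have : polyW w ≤ LinearMap.ker (LieModule.toEnd ℂ W22 V (W n) - algebraMap ℂ _ (psi n)) := by
    refine polyW_le ?_ fun k v hv => ?_
    · simp [h.lie_W n hn]
    · simp only [LinearMap.mem_ker, LinearMap.sub_apply, LieModule.toEnd_apply_apply,
        Module.algebraMap_end_apply, sub_eq_zero] at hv ⊢
      rw [lie_W_W, hv, lie_smul]
  simpa [sub_eq_zero] using this hv

theorem IsEigenvector.lie_W_mem_polyW (h : IsEigenvector lam psi ξ w) (n : ℤ) {v : V}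
    (hv : v ∈ polyW w) : ⁅W n, v⁆ ∈ polyW w := by
  rcases lt_or_ge 0 n with hn | hn
  · rw [h.lie_W_polyW hn hv]
    exact Submodule.smul_mem _ _ hv
  · obtain ⟨k, rfl⟩ : ∃ k : ℕ, n = -(k : ℤ) := ⟨n.natAbs, by omega⟩
    exact lie_W_neg_mem_polyW k hv

theorem IsEigenvector.lie_L_mem_polyW (h : IsEigenvector lam psi ξ w) {n : ℤ} (hn : 0 < n) {v : V}
    (hv : v ∈ polyW w) : ⁅L n, v⁆ ∈ polyW w := by
  have : polyW w ≤ polyW w ⊓ (polyW w).comap (LieModule.toEnd ℂ W22 V (L n)) := by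
    refine polyW_le ⟨self_mem_polyW w, ?_⟩ fun k v hv => ⟨lie_W_neg_mem_polyW k hv.1, ?_⟩
    · simpa [h.lie_L n hn] using Submodule.smul_mem _ _ (self_mem_polyW w)
    · obtain ⟨s, -, hs⟩ := h.lie_L_W n (-(k : ℤ))
      change ⁅L n, ⁅W (-(k : ℤ)), v⁆⁆ ∈ polyW w
      rw [hs]
      exact Submodule.add_mem _ (Submodule.add_mem _ (lie_W_neg_mem_polyW k hv.2)
        (Submodule.smul_mem _ _ (h.lie_W_mem_polyW _ hv.1))) (Submodule.smul_mem _ _ hv.1)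
  exact (this hv).2

/-! ### The filtration by the number of factors `L (-k)` -/

/-- `lFiltration w (d + 2)` is spanned by the vectors `L (-k₁) ⋯ L (-kᵣ) v` with `r ≤ d`
and `v` in `polyW w`. -/
noncomputable def lFiltration (w : V) : ℕ → Submodule ℂ V
  -- Two zero steps precede `polyW w`, so that a drop of two degrees can be stated from every step
  -- on.
  | 0 => ⊥
  | 1 => ⊥
  | 2 => polyW w
  | d + 3 => lFiltration w (d + 2) ⊔
      ⨆ k : ℕ, (lFiltration w (d + 2)).map (LieModule.toEnd ℂ W22 V (L (-(k : ℤ))))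

theorem lFiltration_le_succ (w : V) : ∀ d, lFiltration w d ≤ lFiltration w (d + 1)
  | 0 => le_rfl
  | 1 => bot_le
  | _ + 2 => le_sup_left

theorem lFiltration_mono (w : V) : Monotone (lFiltration w) :=
  monotone_nat_of_le_succ (lFiltration_le_succ w)

theorem lie_L_neg_mem_lFiltration (k : ℕ) : ∀ {d : ℕ} {v : V}, v ∈ lFiltration w d →
    ⁅L (-(k : ℤ)), v⁆ ∈ lFiltration w (d + 1)
  | 0, v, hv => by rw [(Submodule.mem_bot ℂ).mp hv, lie_zero]; exact Submodule.zero_mem _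
  | 1, v, hv => by rw [(Submodule.mem_bot ℂ).mp hv, lie_zero]; exact Submodule.zero_mem _
  | d + 2, v, hv => Submodule.mem_sup_right
      (Submodule.mem_iSup_of_mem k (Submodule.mem_map_of_mem hv))

theorem lFiltration_add_three_le {S : Submodule ℂ V} {d : ℕ} (h : lFiltration w (d + 2) ≤ S)
    (hS : ∀ k : ℕ, ∀ v ∈ lFiltration w (d + 2), ⁅L (-(k : ℤ)), v⁆ ∈ S) :
    lFiltration w (d + 3) ≤ S := by
  refine sup_le h (iSup_le fun k => ?_)
  rintro _ ⟨v, hv, rfl⟩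
  exact hS k v hv

theorem lFiltration_le {S : ℕ → Submodule ℂ V} (h : polyW w ≤ S 2) (hm : ∀ d, S d ≤ S (d + 1))
    (hS : ∀ d, ∀ k : ℕ, ∀ v ∈ lFiltration w d, v ∈ S d → ⁅L (-(k : ℤ)), v⁆ ∈ S (d + 1)) :
    ∀ d, lFiltration w d ≤ S d
  | 0 => bot_le
  | 1 => bot_le
  | 2 => h
  | d + 3 => lFiltration_add_three_le ((lFiltration_le h hm hS (d + 2)).trans (hm _))
      fun k v hv => hS _ k v hv (lFiltration_le h hm hS (d + 2) hv)

theorem IsEigenvector.lie_W_mem_lFiltration (h : IsEigenvector lam psi ξ w) {d : ℕ} {v : V}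
    (hv : v ∈ lFiltration w d) (n : ℤ) : ⁅W n, v⁆ ∈ lFiltration w d := by
  have := lFiltration_le (w := w)
    -- All `n` are treated at once, since commuting past `L (-k)` turns `W n` into `W (n - k)`.
    (S := fun d => ⨅ n : ℤ, (lFiltration w d).comap (LieModule.toEnd ℂ W22 V (W n)))
    (fun v hv => by
      simp only [Submodule.mem_iInf, Submodule.mem_comap, LieModule.toEnd_apply_apply]
      exact fun n => h.lie_W_mem_polyW n hv)
    (fun d => iInf_mono fun n => Submodule.comap_mono (lFiltration_le_succ w d))
    (fun d k v hv hv' => by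
      simp only [Submodule.mem_iInf, Submodule.mem_comap, LieModule.toEnd_apply_apply] at hv' ⊢
      intro n
      obtain ⟨s, -, hs⟩ := h.lie_W_L n (-(k : ℤ))
      rw [hs]
      exact Submodule.add_mem _ (Submodule.add_mem _ (lie_L_neg_mem_lFiltration k (hv' n))
        (Submodule.smul_mem _ _ (lFiltration_le_succ w d (hv' _))))
        (Submodule.smul_mem _ _ (lFiltration_le_succ w d hv))) d hv
  simp only [Submodule.mem_iInf, Submodule.mem_comap, LieModule.toEnd_apply_apply] at this
  exact this n

theorem IsEigenvector.lie_L_mem_lFiltration (h : IsEigenvector lam psi ξ w) {d : ℕ} {v : V}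
    (hv : v ∈ lFiltration w d) {n : ℤ} (hn : 0 < n) : ⁅L n, v⁆ ∈ lFiltration w d := by
  have := lFiltration_le (w := w)
    (S := fun d => ⨅ n : ℤ, ⨅ _ : 0 < n,
      (lFiltration w d).comap (LieModule.toEnd ℂ W22 V (L n)))
    (fun v hv => by
      simp only [Submodule.mem_iInf, Submodule.mem_comap, LieModule.toEnd_apply_apply]
      exact fun n hn => h.lie_L_mem_polyW hn hv)
    (fun d => iInf₂_mono fun n _ => Submodule.comap_mono (lFiltration_le_succ w d))
    (fun d k v hv hv' => by
      simp only [Submodule.mem_iInf, Submodule.mem_comap, LieModule.toEnd_apply_apply] at hv' ⊢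
      intro n hn
      obtain ⟨s, -, hs⟩ := h.lie_L_L n (-(k : ℤ))
      rw [hs]
      refine Submodule.add_mem _ (Submodule.add_mem _ (lie_L_neg_mem_lFiltration k (hv' n hn))
        (Submodule.smul_mem _ _ ?_)) (Submodule.smul_mem _ _ (lFiltration_le_succ w d hv))
      -- For `n ≤ k` the commutator is again some `L (-j)`; it takes the place of the consumed
      -- factor `L (-k)`, so the degree does not rise.
      rcases lt_or_ge 0 (-(k : ℤ) + n) with hkn | hkn
      · exact lFiltration_le_succ w d (hv' _ hkn)
      · obtain ⟨j, hj⟩ : ∃ j : ℕ, -(k : ℤ) + n = -(j : ℤ) := ⟨(-(k : ℤ) + n).natAbs, by omega⟩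
        rw [hj]
        exact lie_L_neg_mem_lFiltration j hv) d hv
  simp only [Submodule.mem_iInf, Submodule.mem_comap, LieModule.toEnd_apply_apply] at this
  exact this n hn

/-- Each commutator of `W n` with a factor `L (-k)` replaces that factor by some `W`, which does not
count; on `polyW w` the difference vanishes. -/
theorem IsEigenvector.lie_W_sub_mem_lFiltration (h : IsEigenvector lam psi ξ w) {d : ℕ} {v : V}
    (hv : v ∈ lFiltration w (d + 1)) {n : ℤ} (hn : 0 < n) :
    ⁅W n, v⁆ - psi n • v ∈ lFiltration w d := by
  have := lFiltration_le (w := w)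
    (S := fun d => (lFiltration w (d - 1)).comap
      (LieModule.toEnd ℂ W22 V (W n) - algebraMap ℂ _ (psi n)))
    (fun v hv => by simp [h.lie_W_polyW hn hv])
    (fun d => Submodule.comap_mono (lFiltration_mono w (by omega)))
    (fun d k v hv hv' => by
      rcases d with _ | d
      · rw [(Submodule.mem_bot ℂ).mp hv, lie_zero]
        exact Submodule.zero_mem _
      simp only [Submodule.mem_comap, LieModule.toEnd_apply_apply, LinearMap.sub_apply,
        Module.algebraMap_end_apply, Nat.add_sub_cancel] at hv' ⊢
      obtain ⟨s, -, hs⟩ := h.lie_W_L n (-(k : ℤ))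
      rw [hs]
      have := Submodule.add_mem _ (Submodule.add_mem _ (lie_L_neg_mem_lFiltration k hv')
        (Submodule.smul_mem _ (((-(k : ℤ) : ℤ) : ℂ) - n) (h.lie_W_mem_lFiltration hv (n + -(k : ℤ)))))
        (Submodule.smul_mem _ s hv)
      convert this using 1
      rw [lie_sub, lie_smul]
      abel) (d + 1) hv
  simpa using this

theorem IsEigenvector.iSup_lFiltration_eq_top (h : IsEigenvector lam psi ξ w)
    (hw : ∀ N : LieSubmodule ℂ W22 V, w ∈ N → N = ⊤) (v : V) : ∃ d, v ∈ lFiltration w d := by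
  have hdir : Directed (· ≤ ·) (lFiltration w) := (lFiltration_mono w).directed_le
  let N : LieSubmodule ℂ W22 V :=
    { toSubmodule := ⨆ d, lFiltration w d
      lie_mem := by
        intro x v hv
        obtain ⟨d, hd⟩ := (Submodule.mem_iSup_of_directed _ hdir).mp hv
        have hx : x ∈ Submodule.span ℂ (Set.range basis) := by rw [basis.span_eq]; trivial
        induction hx using Submodule.span_induction with
        | mem x hx =>
          obtain ⟨i, rfl⟩ := hx
          rcases i with n | n | _
          · rcases lt_or_ge 0 n with hn | hn
            · exact Submodule.mem_iSup_of_mem d (h.lie_L_mem_lFiltration hd hn)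
            · obtain ⟨k, rfl⟩ : ∃ k : ℕ, n = -(k : ℤ) := ⟨n.natAbs, by omega⟩
              exact Submodule.mem_iSup_of_mem (d + 1) (lie_L_neg_mem_lFiltration k hd)
          · exact Submodule.mem_iSup_of_mem d (h.lie_W_mem_lFiltration hd n)
          · change ⁅z, v⁆ ∈ _
            rw [h.lie_z]
            exact Submodule.smul_mem _ _ hv
        | zero => rw [zero_lie]; exact Submodule.zero_mem _
        | add x y _ _ hx hy => rw [add_lie]; exact Submodule.add_mem _ hx hy
        | smul c x _ hx => rw [smul_lie]; exact Submodule.smul_mem _ _ hx }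
  have hN : N = ⊤ := hw N (Submodule.mem_iSup_of_mem 2 (self_mem_polyW w))
  have hv : v ∈ N := by rw [hN]; trivial
  exact (Submodule.mem_iSup_of_directed _ hdir).mp hv

end Action

end W22

namespace W22

section Simplicity

variable {V : Type*} [AddCommGroup V] [Module ℂ V] [LieRingModule W22 V] [LieModule ℂ W22 V]
variable {lam psi : ℤ → ℂ} {ξ : ℂ} {w : V}

/-! ### Lowering the number of factors `L (-k)` -/

/-- The first step `polyW w` followed by the steps of `lFiltration w` of one degree less. -/
noncomputable def shiftedFiltration (w : V) : ℕ → Submodule ℂ V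
  -- The products with no factor `L` form the base in degree 0; in positive degree the base consists
  -- of lower terms only.
  | 0 => polyW w
  | d + 1 => lFiltration w (d + 2)

/-- `lSpan w K d` is spanned, modulo `lFiltration w (d + 1)`, by the vectors
`L (-k₁) ⋯ L (-kᵣ) v` with `r ≤ d`, all `kᵢ < K` and `v` in `polyW w`. -/
noncomputable def lSpan (w : V) : ℕ → ℕ → Submodule ℂ V
  | 0 => shiftedFiltration w
  | K + 1 => ladderSpan (LieModule.toEnd ℂ W22 V (L (-(K : ℤ)))) (lSpan w K)

theorem lSpan_mono (w : V) (d : ℕ) : Monotone fun K => lSpan w K d :=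
  monotone_nat_of_le_succ fun _ => le_ladderSpan _ _ d

theorem lFiltration_le_lSpan (w : V) (K d : ℕ) : lFiltration w (d + 1) ≤ lSpan w K d := by
  refine le_trans ?_ (lSpan_mono w d (Nat.zero_le K))
  cases d with
  | zero => exact bot_le
  | succ d => exact le_rfl

theorem lSpan_le_lFiltration (w : V) (K d : ℕ) : lSpan w K d ≤ lFiltration w (d + 2) := by
  induction K generalizing d with
  | zero =>
    cases d with
    | zero => exact le_rfl
    | succ d => exact lFiltration_le_succ w _
  | succ K ihK =>
    induction d with
    | zero => exact ihK 0
    | succ d ihd =>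
      refine sup_le (ihK _) ?_
      rintro _ ⟨v, hv, rfl⟩
      exact lie_L_neg_mem_lFiltration K (ihd hv)

/-- Reordering is free: exchanging `L (-k)` and `L (-K)` costs a multiple of `L (-(K + k))`, with
one factor fewer. -/
theorem IsEigenvector.lie_L_neg_mem_lSpan (h : IsEigenvector lam psi ξ w) {k K : ℕ} (hk : k < K)
    {d : ℕ} {v : V} (hv : v ∈ lSpan w K d) : ⁅L (-(k : ℤ)), v⁆ ∈ lSpan w K (d + 1) := by
  induction K generalizing d v with
  | zero => omega
  | succ K ihK =>
    rcases Nat.lt_succ_iff_lt_or_eq.mp hk with hk | rfl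
    · induction d generalizing v with
      | zero => exact lSpan_mono w 1 K.le_succ (ihK hk hv)
      | succ d ihd =>
        obtain ⟨u, hu, _, ⟨y, hy, rfl⟩, rfl⟩ := Submodule.mem_sup.mp hv
        rw [lie_add, LieModule.toEnd_apply_apply]
        refine Submodule.add_mem _ (lSpan_mono w _ K.le_succ (ihK hk hu)) ?_
        obtain ⟨s, hs, he⟩ := h.lie_L_L (-(k : ℤ)) (-(K : ℤ))
        rw [he, hs (by omega), zero_smul, add_zero,
          show -(K : ℤ) + -(k : ℤ) = -((K + k : ℕ) : ℤ) by push_cast; ring]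
        exact Submodule.add_mem _ (apply_mem_ladderSpan (ihd hy))
          (Submodule.smul_mem _ _ (lFiltration_le_lSpan w _ _
            (lie_L_neg_mem_lFiltration _ (lSpan_le_lFiltration w (K + 1) d hy))))
    · exact apply_mem_ladderSpan hv

theorem IsEigenvector.exists_mem_lSpan (h : IsEigenvector lam psi ξ w) {d : ℕ} {v : V}
    (hv : v ∈ lFiltration w (d + 2)) : ∃ K, v ∈ lSpan w K d := by
  have hdir (d : ℕ) : Directed (· ≤ ·) fun K => lSpan w K d := (lSpan_mono w d).directed_le
  rw [← Submodule.mem_iSup_of_directed _ (hdir d)]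
  suffices ∀ d, lFiltration w (d + 2) ≤ ⨆ K, lSpan w K d from this d hv
  intro d
  induction d with
  | zero => exact le_iSup (fun K => lSpan w K 0) 0
  | succ d ih =>
    refine lFiltration_add_three_le (le_iSup (fun K => lSpan w K (d + 1)) 0) fun k v hv => ?_
    obtain ⟨K, hK⟩ := (Submodule.mem_iSup_of_directed _ (hdir d)).mp (ih hv)
    exact Submodule.mem_iSup_of_mem (max K (k + 1)) (h.lie_L_neg_mem_lSpan (by omega)
      (lSpan_mono w d (le_max_left K (k + 1)) hK))

/-- The degree drops by two, not one: a commutator with `L (-j)`, `j < K ≤ k`, gives `W (k + 2 - j)`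
of index at least 3. Its eigenvalue is zero, so it lowers the degree once more. -/
theorem IsEigenvector.lie_W_sub_mem_of_mem_lSpan (h : IsEigenvector lam psi ξ w)
    (hpsi : ∀ n, 3 ≤ n → psi n = 0) {k K : ℕ} (hk : K ≤ k) {d : ℕ} {v : V}
    (hv : v ∈ lSpan w K d) : ⁅W ((k : ℤ) + 2), v⁆ - psi (k + 2) • v ∈ lFiltration w d := by
  induction K generalizing d v with
  | zero =>
    cases d with
    | zero =>
      rw [h.lie_W_polyW (by omega) hv, sub_self]
      exact Submodule.zero_mem _
    | succ d => exact h.lie_W_sub_mem_lFiltration hv (by omega)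
  | succ K ihK =>
    induction d generalizing v with
    | zero => exact ihK (by omega) hv
    | succ d ihd =>
      obtain ⟨u, hu, _, ⟨y, hy, rfl⟩, rfl⟩ := Submodule.mem_sup.mp hv
      rw [lie_add, smul_add, add_sub_add_comm, LieModule.toEnd_apply_apply]
      refine Submodule.add_mem _ (ihK (by omega) hu) ?_
      obtain ⟨s, hs, he⟩ := h.lie_W_L ((k : ℤ) + 2) (-(K : ℤ))
      rw [he, hs (by omega), zero_smul, add_zero, add_sub_right_comm, ← lie_smul, ← lie_sub]
      have h1 := h.lie_W_sub_mem_lFiltration (lSpan_le_lFiltration w (K + 1) d hy)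
        (n := (k : ℤ) + 2 + -(K : ℤ)) (by omega)
      rw [hpsi _ (by omega), zero_smul, sub_zero] at h1
      exact Submodule.add_mem _ (lie_L_neg_mem_lFiltration K (ihd hy)) (Submodule.smul_mem _ _ h1)

/-- A vanishing derivative in `L (-K)` removes that variable. The ladder constant comes from `[W (K
+ 2), L (-K)] = -(2 K + 2) W 2`, where `W 2` acts as `psi 2` modulo lower degree. -/
theorem IsEigenvector.mem_lSpan_of_lie_W (h : IsEigenvector lam psi ξ w) (h2 : psi 2 ≠ 0)
    (hpsi : ∀ n, 3 ≤ n → psi n = 0) {K d : ℕ} {v : V} (hv : v ∈ lSpan w (K + 1) d)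
    (hv' : ⁅W ((K : ℤ) + 2), v⁆ - psi (K + 2) • v ∈ lFiltration w d) : v ∈ lSpan w K d := by
  have hc : (-(2 * (K : ℂ) + 2)) * psi 2 ≠ 0 := by
    refine mul_ne_zero (neg_ne_zero.mpr ?_) h2
    exact_mod_cast (by omega : 2 * K + 2 ≠ 0)
  refine mem_of_mem_ladderSpan (A := LieModule.toEnd ℂ W22 V (L (-(K : ℤ))))
    (D := LieModule.toEnd ℂ W22 V (W ((K : ℤ) + 2)) - algebraMap ℂ _ (psi (K + 2))) hc
    (Z := fun d => lFiltration w (d + 1)) (fun d => lFiltration_le_lSpan w K d)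
    (fun d v hv => ?_) (fun d v hv => lie_L_neg_mem_lFiltration K hv) (fun d v hv => ?_) hv ?_
  · exact lie_L_neg_mem_lFiltration K (h.lie_W_sub_mem_of_mem_lSpan hpsi le_rfl hv)
  · refine lie_L_neg_mem_lFiltration K ?_
    obtain ⟨s, hs, he⟩ := h.lie_W_L ((K : ℤ) + 2) (-(K : ℤ))
    have h1 := h.lie_W_sub_mem_lFiltration (lSpan_le_lFiltration w (K + 1) d hv)
      (n := 2) (by omega)
    have h3 := Submodule.smul_mem _ (-(2 * (K : ℂ) + 2)) h1
    convert h3 using 1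
    simp only [LinearMap.sub_apply, LieModule.toEnd_apply_apply, Module.algebraMap_end_apply]
    rw [he, hs (by omega), zero_smul, add_zero, show (K : ℤ) + 2 + -(K : ℤ) = 2 by ring, lie_sub,
      lie_smul]
    push_cast
    module
  · exact lie_L_neg_mem_lFiltration K hv'

/-- The variables `L (-K)` are removed from the largest `K` downwards; with none left, only lower
terms remain. -/
theorem IsEigenvector.mem_lFiltration_of_lie_W (h : IsEigenvector lam psi ξ w) (h2 : psi 2 ≠ 0)
    (hpsi : ∀ n, 3 ≤ n → psi n = 0) {d : ℕ} {v : V} (hv : v ∈ lFiltration w (d + 3))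
    (hv' : ∀ K : ℕ, ⁅W ((K : ℤ) + 2), v⁆ - psi (K + 2) • v ∈ lFiltration w (d + 1)) :
    v ∈ lFiltration w (d + 2) := by
  obtain ⟨K, hK⟩ := h.exists_mem_lSpan hv
  induction K with
  | zero => exact hK
  | succ K ih => exact ih (h.mem_lSpan_of_lie_W h2 hpsi hK (hv' K))

theorem IsEigenvector.exists_mem_polyW (h : IsEigenvector lam psi ξ w) (h2 : psi 2 ≠ 0)
    (hpsi : ∀ n, 3 ≤ n → psi n = 0) (N : LieSubmodule ℂ W22 V) :
    ∀ {d : ℕ} {v : V}, v ∈ lFiltration w d → v ∈ N → v ≠ 0 → ∃ u ∈ polyW w, u ∈ N ∧ u ≠ 0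
  | 0, _, hv, _, hv0 => absurd ((Submodule.mem_bot ℂ).mp hv) hv0
  | 1, _, hv, _, hv0 => absurd ((Submodule.mem_bot ℂ).mp hv) hv0
  | 2, v, hv, hvN, hv0 => ⟨v, hv, hvN, hv0⟩
  | d + 3, v, hv, hvN, hv0 => by
    by_cases hv2 : v ∈ lFiltration w (d + 2)
    · exact h.exists_mem_polyW h2 hpsi N hv2 hvN hv0
    · obtain ⟨K, hK⟩ : ∃ K : ℕ,
          ⁅W ((K : ℤ) + 2), v⁆ - psi (K + 2) • v ∉ lFiltration w (d + 1) := by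
        by_contra! hc
        exact hv2 (h.mem_lFiltration_of_lie_W h2 hpsi hv hc)
      exact h.exists_mem_polyW h2 hpsi N (h.lie_W_sub_mem_lFiltration hv (n := (K : ℤ) + 2) (by omega))
        (N.sub_mem (N.lie_mem hvN) (N.smul_mem _ hvN))
        (fun h0 => hK (by rw [h0]; exact Submodule.zero_mem _))

/-! ### Lowering the number of factors `W (-k)` -/

/-- The span of the vectors `W (-k₁) ⋯ W (-kᵣ) w` with all `kᵢ < K`. -/
noncomputable def wSpan (w : V) : ℕ → Submodule ℂ V
  | 0 => Submodule.span ℂ {w}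
  | K + 1 => ⨆ d, ladderSpan (LieModule.toEnd ℂ W22 V (W (-(K : ℤ)))) (fun _ => wSpan w K) d

theorem mem_wSpan_succ {K : ℕ} {v : V} : v ∈ wSpan w (K + 1) ↔
    ∃ d, v ∈ ladderSpan (LieModule.toEnd ℂ W22 V (W (-(K : ℤ)))) (fun _ => wSpan w K) d :=
  Submodule.mem_iSup_of_directed _ (ladderSpan_const_mono _ _).directed_le

theorem wSpan_mono (w : V) : Monotone (wSpan w) :=
  monotone_nat_of_le_succ fun _ => le_iSup_of_le 0 le_rfl

theorem lie_W_neg_mem_wSpan {k K : ℕ} (hk : k < K) {v : V} (hv : v ∈ wSpan w K) :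
    ⁅W (-(k : ℤ)), v⁆ ∈ wSpan w K := by
  induction K generalizing v with
  | zero => omega
  | succ K ihK =>
    obtain ⟨d, hd⟩ := mem_wSpan_succ.mp hv
    rcases Nat.lt_succ_iff_lt_or_eq.mp hk with hk | rfl
    · refine mem_wSpan_succ.mpr ⟨d, ?_⟩
      clear hv
      induction d generalizing v with
      | zero => exact ihK hk hd
      | succ d ihd =>
        obtain ⟨u, hu, _, ⟨y, hy, rfl⟩, rfl⟩ := Submodule.mem_sup.mp hd
        rw [lie_add, LieModule.toEnd_apply_apply, lie_W_W]
        exact Submodule.add_mem _ (le_ladderSpan _ _ _ (ihK hk hu))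
          (apply_mem_ladderSpan (ihd hy))
    · exact mem_wSpan_succ.mpr ⟨d + 1, apply_mem_ladderSpan hd⟩

theorem exists_mem_wSpan {v : V} (hv : v ∈ polyW w) : ∃ K, v ∈ wSpan w K := by
  have hdir : Directed (· ≤ ·) (wSpan w) := (wSpan_mono w).directed_le
  rw [← Submodule.mem_iSup_of_directed _ hdir]
  refine polyW_le (Submodule.mem_iSup_of_mem 0 (Submodule.mem_span_singleton_self w))
    (fun k v hv => ?_) hv
  obtain ⟨K, hK⟩ := (Submodule.mem_iSup_of_directed _ hdir).mp hv
  exact Submodule.mem_iSup_of_mem (max K (k + 1))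
    (lie_W_neg_mem_wSpan (by omega) (wSpan_mono w (le_max_left K (k + 1)) hK))

theorem wSpan_le_polyW (w : V) (K : ℕ) : wSpan w K ≤ polyW w := by
  induction K with
  | zero => exact (Submodule.span_singleton_le_iff_mem w _).mpr (self_mem_polyW w)
  | succ K ih =>
    refine iSup_le fun d => ?_
    induction d with
    | zero => exact ih
    | succ d ihd =>
      refine sup_le ih ?_
      rintro _ ⟨v, hv, rfl⟩
      exact lie_W_neg_mem_polyW K (ihd hv)

/-- On `polyW w` the commutator `W (k + 2 - K)` is an exact scalar, so no lower terms appear in this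
half of the argument. -/
theorem IsEigenvector.lie_L_lie_W (h : IsEigenvector lam psi ξ w) {k K : ℕ} (hk : K ≤ k) {v : V}
    (hv : v ∈ polyW w) : ⁅L ((k : ℤ) + 2), ⁅W (-(K : ℤ)), v⁆⁆ =
      ⁅W (-(K : ℤ)), ⁅L ((k : ℤ) + 2), v⁆⁆ +
        (-((K : ℂ) + k + 2) * psi (-(K : ℤ) + ((k : ℤ) + 2))) • v := by
  obtain ⟨s, hs, he⟩ := h.lie_L_W ((k : ℤ) + 2) (-(K : ℤ))
  rw [he, hs (by omega), zero_smul, add_zero, h.lie_W_polyW (by omega) hv, smul_smul]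
  congr 3
  push_cast
  ring

theorem IsEigenvector.lie_L_of_mem_wSpan (h : IsEigenvector lam psi ξ w)
    (hpsi : ∀ n, 3 ≤ n → psi n = 0) {k K : ℕ} (hk : K ≤ k) {v : V} (hv : v ∈ wSpan w K) :
    ⁅L ((k : ℤ) + 2), v⁆ = lam (k + 2) • v := by
  induction K generalizing v with
  | zero =>
    obtain ⟨c, rfl⟩ := Submodule.mem_span_singleton.mp hv
    rw [lie_smul, h.lie_L _ (by omega), smul_comm]
  | succ K ihK =>
    obtain ⟨d, hd⟩ := mem_wSpan_succ.mp hv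
    clear hv
    induction d generalizing v with
    | zero => exact ihK (by omega) hd
    | succ d ihd =>
      obtain ⟨u, hu, _, ⟨y, hy, rfl⟩, rfl⟩ := Submodule.mem_sup.mp hd
      rw [lie_add, smul_add, LieModule.toEnd_apply_apply, ihK (by omega) hu,
        h.lie_L_lie_W (by omega) (wSpan_le_polyW w (K + 1) (mem_wSpan_succ.mpr ⟨d, hy⟩)), ihd hy,
        hpsi _ (by omega), mul_zero, zero_smul, add_zero, lie_smul]

theorem IsEigenvector.mem_of_mem_wSpan (h : IsEigenvector lam psi ξ w) (h2 : psi 2 ≠ 0)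
    (hpsi : ∀ n, 3 ≤ n → psi n = 0) (N : LieSubmodule ℂ W22 V) {K : ℕ} {v : V}
    (hv : v ∈ wSpan w K) (hvN : v ∈ N) (hv0 : v ≠ 0) : w ∈ N := by
  induction K generalizing v with
  | zero =>
    obtain ⟨c, rfl⟩ := Submodule.mem_span_singleton.mp hv
    have hc : c ≠ 0 := fun hc => hv0 (by rw [hc, zero_smul])
    exact (N.toSubmodule.smul_mem_iff hc).mp hvN
  | succ K ih =>
    let A := LieModule.toEnd ℂ W22 V (W (-(K : ℤ)))
    let D := LieModule.toEnd ℂ W22 V (L ((K : ℤ) + 2)) - algebraMap ℂ _ (lam (K + 2))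
    have hD (u : V) : D u = ⁅L ((K : ℤ) + 2), u⁆ - lam (K + 2) • u := rfl
    have hDH (u : V) (hu : u ∈ wSpan w K) : D u = 0 := by
      rw [hD, h.lie_L_of_mem_wSpan hpsi le_rfl hu, sub_self]
    have hc : (-((K : ℂ) + K + 2)) * psi 2 ≠ 0 := by
      refine mul_ne_zero (neg_ne_zero.mpr ?_) h2
      exact_mod_cast (by omega : K + K + 2 ≠ 0)
    have hDA (d : ℕ) (u : V) (hu : u ∈ ladderSpan A (fun _ => wSpan w K) d) :
        D (A u) = A (D u) + ((-((K : ℂ) + K + 2)) * psi 2) • u := by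
      have := h.lie_L_lie_W (le_refl K) (wSpan_le_polyW w (K + 1) (mem_wSpan_succ.mpr ⟨d, hu⟩))
      rw [show -(K : ℤ) + ((K : ℤ) + 2) = 2 by ring] at this
      rw [hD, hD]
      simp only [A, LieModule.toEnd_apply_apply, this, lie_sub, lie_smul]
      abel
    have hker (d : ℕ) (u : V) (hu : u ∈ ladderSpan A (fun _ => wSpan w K) d) (hDu : D u = 0) :
        u ∈ wSpan w K :=
      mem_of_mem_ladderSpan (D := D) hc (Z := fun _ => ⊥) (H := fun _ => wSpan w K) (fun _ => bot_le)
        (fun d u hu => by rw [hDH u hu, map_zero]; exact Submodule.zero_mem _)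
        (fun d u hu => by
          rw [(Submodule.mem_bot ℂ).mp hu, map_zero]; exact Submodule.zero_mem _)
        (fun d u hu => by rw [hDA d u hu]; simp) hu
        (by rw [hDu, map_zero]; exact Submodule.zero_mem _)
    -- As a derivative in `W (-K)`, `D` lowers the degree in that variable, so repeated application
    -- terminates.
    have hDs (d : ℕ) : ∀ u ∈ ladderSpan A (fun _ => wSpan w K) (d + 1),
        D u ∈ ladderSpan A (fun _ => wSpan w K) d := by
      induction d with
      | zero =>
        rintro _ hv
        obtain ⟨u, hu, _, ⟨y, hy, rfl⟩, rfl⟩ := Submodule.mem_sup.mp hv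
        rw [map_add, hDH u hu, zero_add, hDA 0 y hy, hDH y hy, map_zero, zero_add]
        exact Submodule.smul_mem _ _ hy
      | succ d ihd =>
        rintro _ hv
        obtain ⟨u, hu, _, ⟨y, hy, rfl⟩, rfl⟩ := Submodule.mem_sup.mp hv
        rw [map_add, hDH u hu, zero_add, hDA _ y hy]
        exact Submodule.add_mem _ (apply_mem_ladderSpan (ihd y hy)) (Submodule.smul_mem _ _ hy)
    obtain ⟨d, hd⟩ := mem_wSpan_succ.mp hv
    clear hv
    induction d generalizing v with
    | zero => exact ih hd hvN hv0
    | succ d ihd =>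
      by_cases hDv : D v = 0
      · exact ih (hker _ v hd hDv) hvN hv0
      · exact ihd (N.sub_mem (N.lie_mem hvN) (N.smul_mem _ hvN)) hDv (hDs d v hd)

/-- A nonzero submodule of a Whittaker module on which `z` acts as a scalar contains the
cyclic Whittaker vector. -/
theorem IsEigenvector.eq_top_of_ne_bot (h : IsEigenvector lam psi ξ w) (h2 : psi 2 ≠ 0)
    (hpsi : ∀ n, 3 ≤ n → psi n = 0) (hw : ∀ N : LieSubmodule ℂ W22 V, w ∈ N → N = ⊤)
    {N : LieSubmodule ℂ W22 V} (hN : N ≠ ⊥) : N = ⊤ := by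
  obtain ⟨v, hvN, hv0⟩ : ∃ v ∈ N, v ≠ 0 := by
    contrapose! hN
    exact (LieSubmodule.eq_bot_iff N).mpr hN
  obtain ⟨d, hd⟩ := h.iSup_lFiltration_eq_top hw v
  obtain ⟨u, hu, huN, hu0⟩ := h.exists_mem_polyW h2 hpsi N hd hvN hv0
  obtain ⟨K, hK⟩ := exists_mem_wSpan hu
  exact hw N (h.mem_of_mem_wSpan h2 hpsi N hK huN hu0)

end Simplicity

end W22

/-! ### Enveloping algebras, cyclic submodules and powers of `z - ξ`. -/

/-- The elements satisfying `p` form a subalgebra; lifting `ι` into it and then including is the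
identity by the universal property. -/
theorem UniversalEnvelopingAlgebra.induction_on {R L : Type*} [CommRing R] [LieRing L]
    [LieAlgebra R L] {p : UniversalEnvelopingAlgebra R L → Prop}
    (algebraMap : ∀ r, p (algebraMap R _ r)) (ι : ∀ x, p (ι R x))
    (mul : ∀ a b, p a → p b → p (a * b)) (add : ∀ a b, p a → p b → p (a + b))
    (a : UniversalEnvelopingAlgebra R L) : p a := by
  let S : Subalgebra R (UniversalEnvelopingAlgebra R L) :=
    { carrier := {a | p a}
      mul_mem' := fun {a b} ha hb => mul a b ha hb
      add_mem' := fun {a b} ha hb => add a b ha hb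
      algebraMap_mem' := algebraMap }
  let f : L →ₗ⁅R⁆ S :=
    { toFun := fun x => ⟨UniversalEnvelopingAlgebra.ι R x, ι x⟩
      map_add' := fun x y => Subtype.ext (map_add _ x y)
      map_smul' := fun c x => Subtype.ext (map_smul _ c x)
      map_lie' := fun {x y} => Subtype.ext (LieHom.map_lie _ x y) }
  have h : S.val.comp (lift R f) = AlgHom.id R _ := by
    ext x
    simp [f]
  have h' := AlgHom.congr_fun h a
  rw [AlgHom.id_apply] at h'
  rw [← h']
  exact (lift R f a).2

namespace W22

theorem lie_z_comm {V : Type*} [AddCommGroup V] [LieRingModule W22 V] (x : W22) (v : V) :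
    ⁅z, ⁅x, v⁆⁆ = ⁅x, ⁅z, v⁆⁆ := by
  rw [leibniz_lie, lie_def, z_bracketMap, zero_lie, zero_add]

section Cyclic

variable {V : Type*} [AddCommGroup V] [Module ℂ V] [LieRingModule W22 V] [LieModule ℂ W22 V]

theorem uAction_toU (x : W22) (v : V) : uAction V (toU x) v = ⁅x, v⁆ := by
  simp [uAction]

theorem uAction_mem (N : LieSubmodule ℂ W22 V) (u : U) {v : V} (hv : v ∈ N) :
    uAction V u v ∈ N := by
  induction u using UniversalEnvelopingAlgebra.induction_on generalizing v with
  | algebraMap r => simpa using N.smul_mem r hv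
  | ι x => rw [uAction_toU]; exact N.lie_mem hv
  | mul a b ha hb => rw [map_mul]; exact ha (hb hv)
  | add a b ha hb => rw [map_add]; exact N.add_mem (ha hv) (hb hv)

theorem self_mem_cyclicSubmodule (v : V) : v ∈ cyclicSubmodule v := ⟨1, by simp⟩

theorem cyclicSubmodule_le {N : LieSubmodule ℂ W22 V} {v : V} (hv : v ∈ N) :
    cyclicSubmodule v ≤ N := by
  rintro _ ⟨u, rfl⟩
  exact uAction_mem N u hv

theorem uAction_z_sub (ξ : ℂ) (v : V) :
    uAction V (toU z - algebraMap ℂ U ξ) v = ⁅z, v⁆ - ξ • v := by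
  simp [uAction]

/-- The action of `(z - ξ) ^ i`, as a homomorphism of modules. -/
noncomputable def zPow (V : Type*) [AddCommGroup V] [Module ℂ V] [LieRingModule W22 V]
    [LieModule ℂ W22 V] (ξ : ℂ) (i : ℕ) : V →ₗ⁅ℂ, W22⁆ V :=
  { uAction V ((toU z - algebraMap ℂ U ξ) ^ i) with
    map_lie' := by
      intro x v
      change uAction V ((toU z - algebraMap ℂ U ξ) ^ i) ⁅x, v⁆ =
        ⁅x, uAction V ((toU z - algebraMap ℂ U ξ) ^ i) v⁆
      induction i generalizing v with
      | zero => simp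
      | succ i ih =>
        rw [pow_succ, map_mul, Module.End.mul_apply, Module.End.mul_apply, uAction_z_sub,
          uAction_z_sub, lie_z_comm, ← lie_smul, ← lie_sub, ih] }

theorem zPow_apply (ξ : ℂ) (i : ℕ) (v : V) :
    zPow V ξ i v = uAction V ((toU z - algebraMap ℂ U ξ) ^ i) v := rfl

theorem zPow_one (ξ : ℂ) (v : V) : zPow V ξ 1 v = ⁅z, v⁆ - ξ • v := by
  rw [zPow_apply, pow_one, uAction_z_sub]

theorem zPow_zPow (ξ : ℂ) (i j : ℕ) (v : V) : zPow V ξ i (zPow V ξ j v) = zPow V ξ (i + j) v := by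
  simp only [zPow_apply, pow_add, map_mul, Module.End.mul_apply]

end Cyclic

/-! ### Whittaker vectors and the simplicity criterion. -/

theorem IsWhittakerVector.map {V X : Type*} [AddCommGroup V] [Module ℂ V]
    [LieRingModule W22 V] [AddCommGroup X] [Module ℂ X] [LieRingModule W22 X]
    {φ : plus →ₗ⁅ℂ⁆ ℂ} {v : V} (hv : IsWhittakerVector φ v) (f : V →ₗ⁅ℂ, W22⁆ X) :
    IsWhittakerVector φ (f v) := fun x => by
  rw [← LieModuleHom.map_lie, hv x, map_smul]

section Whittaker

variable {V : Type*} [AddCommGroup V] [Module ℂ V] [LieRingModule W22 V] [LieModule ℂ W22 V]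
variable {φ : plus →ₗ⁅ℂ⁆ ℂ}

/-- A character kills brackets, and `[L 1, W (n - 1)] = (n - 2) W n`. -/
theorem map_plusW_eq_zero (φ : plus →ₗ⁅ℂ⁆ ℂ) {n : ℤ} (hn : 3 ≤ n) :
    φ (plusW n (by omega)) = 0 := by
  have h : ⁅plusL 1 one_pos, plusW (n - 1) (by omega)⁆ =
      ((n : ℂ) - 2) • plusW n (by omega) := by
    refine Subtype.ext ?_
    change bracketMap (L 1) (W (n - 1)) = ((n : ℂ) - 2) • W n
    rw [bracketMap_L_W, central_of_ne (by omega), add_zero, sub_add_cancel]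
    congr 1
    push_cast
    ring
  have h' := congrArg φ h
  rw [LieHom.map_lie, LieRing.of_associative_ring_bracket, mul_comm, sub_self, map_smul,
    smul_eq_mul] at h'
  refine (mul_eq_zero.mp h'.symm).resolve_left (sub_ne_zero.mpr ?_)
  exact_mod_cast (by omega : n ≠ 2)

/-- A module generated by a nonzero Whittaker vector of non-singular type, on which `z` acts by
a scalar, is simple. -/
theorem IsWhittakerVector.isIrreducible (hφ : IsNonsingular φ) {v : V}
    (hv : IsWhittakerVector φ v) {ξ : ℂ} (hz : ∀ u : V, ⁅z, u⁆ = ξ • u)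
    (hgen : ∀ N : LieSubmodule ℂ W22 V, v ∈ N → N = ⊤) (h0 : v ≠ 0) :
    LieModule.IsIrreducible ℂ W22 V := by
  have : Nontrivial V := ⟨v, 0, h0⟩
  have h : IsEigenvector (fun n => if hn : 0 < n then φ (plusL n hn) else 0)
      (fun n => if hn : 0 < n then φ (plusW n hn) else 0) ξ v :=
    { lie_L := fun n hn => by simp only [dif_pos hn]; exact hv (plusL n hn)
      lie_W := fun n hn => by simp only [dif_pos hn]; exact hv (plusW n hn)
      lie_z := hz }
  refine LieModule.IsIrreducible.mk fun N hN => h.eq_top_of_ne_bot ?_ (fun n hn => ?_) hgen hN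
  · simpa using right_ne_zero_of_mul hφ.2
  · rw [dif_pos (by omega), map_plusW_eq_zero φ hn]

theorem IsWhittakerVector.uAction_uPlusToU {v : V} (hv : IsWhittakerVector φ v) (n : UPlus) :
    uAction V (uPlusToU n) v = UniversalEnvelopingAlgebra.lift ℂ φ n • v := by
  induction n using UniversalEnvelopingAlgebra.induction_on with
  | algebraMap r => simp
  | ι x =>
    have : uPlusToU (UniversalEnvelopingAlgebra.ι ℂ x) = toU (x : W22) := by simp [uPlusToU]
    rw [this, uAction_toU, hv x, UniversalEnvelopingAlgebra.lift_ι_apply]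
  | mul a b ha hb =>
    rw [map_mul, map_mul, map_mul, Module.End.mul_apply, hb, map_smul, ha, smul_smul, mul_comm]
  | add a b ha hb => rw [map_add, map_add, map_add, LinearMap.add_apply, ha, hb, add_smul]

/-! ### Maps out of the universal Whittaker module -/

/-- The generator `1 ⊗ 1` of `M_φ`. -/
noncomputable def universalVector (φ : plus →ₗ⁅ℂ⁆ ℂ) : universalModule φ :=
  (Submodule.Quotient.mk (1 ⊗ₜ[ℂ] 1) :
    (U ⊗[ℂ] ℂ) ⧸ Submodule.span U (balancingRelations φ))

/-- The map `U ⊗ ℂ → V` sending `u ⊗ α` to `α u v`. -/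
noncomputable def tensorMap (v : V) : U ⊗[ℂ] ℂ →ₗ[ℂ] V :=
  (uAction V).toLinearMap.flip v ∘ₗ (TensorProduct.rid ℂ U).toLinearMap

theorem tensorMap_tmul (v : V) (u : U) (α : ℂ) : tensorMap v (u ⊗ₜ α) = α • uAction V u v := by
  simp [tensorMap]

theorem tensorMap_smul (v : V) (u : U) (t : U ⊗[ℂ] ℂ) :
    tensorMap v (u • t) = uAction V u (tensorMap v t) := by
  induction t using TensorProduct.induction_on with
  | zero => rw [smul_zero, map_zero, map_zero]
  | tmul u' α =>
    rw [TensorProduct.smul_tmul', tensorMap_tmul, tensorMap_tmul, smul_eq_mul, map_mul, map_smul,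
      Module.End.mul_apply]
  | add s t hs ht => rw [smul_add, map_add, map_add, map_add, hs, ht]

theorem IsWhittakerVector.tensorMap_eq_zero {v : V} (hv : IsWhittakerVector φ v) {t : U ⊗[ℂ] ℂ}
    (ht : t ∈ Submodule.span U (balancingRelations φ)) : tensorMap v t = 0 := by
  induction ht using Submodule.span_induction with
  | mem t ht =>
    obtain ⟨u, n, α, rfl⟩ := ht
    rw [map_sub, tensorMap_tmul, tensorMap_tmul, map_mul, Module.End.mul_apply,
      hv.uAction_uPlusToU, map_smul, smul_smul, mul_comm, sub_self]
  | zero => exact map_zero _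
  | add s t _ _ hs ht => rw [map_add, hs, ht, add_zero]
  | smul u t _ ht => rw [tensorMap_smul, ht, map_zero]

/-- The homomorphism `M_φ → V` given by a Whittaker vector of `V`. -/
noncomputable def universalMap {v : V} (hv : IsWhittakerVector φ v) :
    universalModule φ →ₗ⁅ℂ, W22⁆ V :=
  { ((Submodule.span U (balancingRelations φ)).restrictScalars ℂ).liftQ (tensorMap v)
        (fun _ ht => hv.tensorMap_eq_zero ht) ∘ₗ
      (Submodule.Quotient.restrictScalarsEquiv ℂ
        (Submodule.span U (balancingRelations φ))).symm.toLinearMap with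
    map_lie' := by
      intro x m
      obtain ⟨t, rfl⟩ := Submodule.Quotient.mk_surjective _ m
      exact (tensorMap_smul v (toU x) t).trans (uAction_toU x _) }

theorem universalMap_universalVector {v : V} (hv : IsWhittakerVector φ v) :
    universalMap hv (universalVector φ) = v := by
  change tensorMap v (1 ⊗ₜ 1) = v
  rw [tensorMap_tmul, map_one, one_smul, Module.End.one_apply]

theorem uAction_universalModule (u : U) (m : universalModule φ) :
    uAction (universalModule φ) u m = u • m := by
  induction u using UniversalEnvelopingAlgebra.induction_on generalizing m with
  | algebraMap r => simp
  | ι x => exact uAction_toU x m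
  | mul a b ha hb => rw [map_mul, Module.End.mul_apply, hb, ha, mul_smul]
  | add a b ha hb => rw [map_add, LinearMap.add_apply, ha, hb, add_smul]

theorem isWhittakerVector_universalVector (φ : plus →ₗ⁅ℂ⁆ ℂ) :
    IsWhittakerVector φ (universalVector φ) := by
  intro x
  change (Submodule.Quotient.mk (toU (x : W22) • (1 ⊗ₜ[ℂ] 1)) :
    (U ⊗[ℂ] ℂ) ⧸ Submodule.span U (balancingRelations φ)) = Submodule.Quotient.mk (φ x • 1 ⊗ₜ[ℂ] 1)
  rw [Submodule.Quotient.eq]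
  refine Submodule.subset_span ⟨1, UniversalEnvelopingAlgebra.ι ℂ x, 1, ?_⟩
  rw [TensorProduct.smul_tmul', ← TensorProduct.tmul_smul,
    UniversalEnvelopingAlgebra.lift_ι_apply]
  simp [uPlusToU]

theorem eq_top_of_universalVector_mem {N : LieSubmodule ℂ W22 (universalModule φ)}
    (hN : universalVector φ ∈ N) : N = ⊤ := by
  refine eq_top_iff.mpr fun m _ => ?_
  obtain ⟨t, rfl⟩ := Submodule.Quotient.mk_surjective _ m
  induction t using TensorProduct.induction_on with
  | zero => exact N.zero_mem
  | tmul u α =>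
    have h : u ⊗ₜ[ℂ] α = (α • u) • ((1 : U) ⊗ₜ[ℂ] (1 : ℂ)) := by
      rw [TensorProduct.smul_tmul', smul_eq_mul, mul_one, TensorProduct.smul_tmul, smul_eq_mul,
        mul_one]
    rw [h]
    have := uAction_mem N (α • u) hN
    rwa [uAction_universalModule] at this
  | add s t hs ht => exact N.add_mem (hs trivial) (ht trivial)

theorem lie_z_simpleQuotient (φ : plus →ₗ⁅ℂ⁆ ℂ) (ξ : ℂ) (u : simpleQuotient φ ξ) :
    ⁅z, u⁆ = ξ • u := by
  obtain ⟨m, rfl⟩ := LieSubmodule.Quotient.surjective_mk' _ u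
  rw [← LieModuleHom.map_lie, ← map_smul, ← sub_eq_zero, ← map_sub,
    LieSubmodule.Quotient.mk_eq_zero, ← uAction_z_sub]
  exact ⟨m, rfl⟩

/-- A simple module generated by a Whittaker vector on which `z` acts by `ξ` is `L_{φ,ξ}`. -/
theorem IsWhittakerVector.nonempty_equiv (hφ : IsNonsingular φ) {v : V}
    (hv : IsWhittakerVector φ v) {ξ : ℂ} (hz : ∀ u : V, ⁅z, u⁆ = ξ • u)
    (hgen : ∀ N : LieSubmodule ℂ W22 V, v ∈ N → N = ⊤) (h0 : v ≠ 0) :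
    Nonempty (V ≃ₗ⁅ℂ, W22⁆ simpleQuotient φ ξ) := by
  let π := LieSubmodule.Quotient.mk' (zSubRange (universalModule φ) ξ)
  have hker : (zSubRange (universalModule φ) ξ).toSubmodule ≤
      LinearMap.ker (universalMap hv).toLinearMap := by
    rintro _ ⟨m, rfl⟩
    rw [LinearMap.mem_ker, uAction_z_sub]
    change universalMap hv (⁅z, m⁆ - ξ • m) = 0
    rw [map_sub, LieModuleHom.map_lie, map_smul, hz, sub_self]
  let g : simpleQuotient φ ξ →ₗ⁅ℂ, W22⁆ V :=
    { (zSubRange (universalModule φ) ξ).toSubmodule.liftQ (universalMap hv).toLinearMap hker with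
      map_lie' := by
        intro x u
        obtain ⟨m, rfl⟩ := LieSubmodule.Quotient.surjective_mk' _ u
        exact LieModuleHom.map_lie (universalMap hv) x m }
  have hg : g (π (universalVector φ)) = v := universalMap_universalVector hv
  -- The criterion applies to `L_{φ,ξ}` itself; its generator is nonzero because `g` sends it to `v
  -- ≠ 0`.
  have hirr : LieModule.IsIrreducible ℂ W22 (simpleQuotient φ ξ) := by
    refine ((isWhittakerVector_universalVector φ).map π).isIrreducible hφ
      (lie_z_simpleQuotient φ ξ) (fun N hN => ?_) (fun h => h0 ?_)
    · have h : N.comap π = ⊤ := eq_top_of_universalVector_mem hN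
      refine eq_top_iff.mpr fun u _ => ?_
      obtain ⟨m, rfl⟩ := LieSubmodule.Quotient.surjective_mk' _ u
      have hm : m ∈ N.comap π := by rw [h]; trivial
      exact hm
    · rw [← hg, h, map_zero]
  have hinj : Function.Injective g := by
    rw [← LieModuleHom.ker_eq_bot]
    refine (eq_bot_or_eq_top g.ker).resolve_right fun h => h0 ?_
    have : π (universalVector φ) ∈ g.ker := by rw [h]; trivial
    rw [← hg]
    exact g.mem_ker.mp this
  have hsurj : Function.Surjective g := by
    rw [← LieModuleHom.range_eq_top]
    exact hgen _ ((LieModuleHom.mem_range g _).mpr ⟨_, hg⟩)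
  let e := LinearEquiv.ofBijective g.toLinearMap ⟨hinj, hsurj⟩
  exact ⟨({ e with map_lie' := fun {x m} => g.map_lie x m } : simpleQuotient φ ξ ≃ₗ⁅ℂ, W22⁆ V).symm⟩

end Whittaker

end W22

/-! ### The series `V_i` and all submodules. -/

namespace W22

section Series

variable {V : Type*} [AddCommGroup V] [Module ℂ V] [LieRingModule W22 V] [LieModule ℂ W22 V]
variable {φ : plus →ₗ⁅ℂ⁆ ℂ} {w : V} {ξ : ℂ}

theorem zPow_mem_seriesSubmodule (w : V) (ξ : ℂ) (i : ℕ) :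
    zPow V ξ i w ∈ seriesSubmodule w ξ i := self_mem_cyclicSubmodule _

theorem seriesSubmodule_le {N : LieSubmodule ℂ W22 V} {i : ℕ} (h : zPow V ξ i w ∈ N) :
    seriesSubmodule w ξ i ≤ N := cyclicSubmodule_le h

theorem zPow_mem_seriesSubmodule_add {i : ℕ} (j : ℕ) {v : V} (hv : v ∈ seriesSubmodule w ξ i) :
    zPow V ξ j v ∈ seriesSubmodule w ξ (j + i) := by
  have : seriesSubmodule w ξ i ≤ (seriesSubmodule w ξ (j + i)).comap (zPow V ξ j) := by
    refine seriesSubmodule_le ?_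
    rw [LieSubmodule.mem_comap, zPow_zPow]
    exact zPow_mem_seriesSubmodule w ξ _
  exact this hv

theorem zPow_mem_lieSubmodule (N : LieSubmodule ℂ W22 V) (j : ℕ) {v : V} (hv : v ∈ N) :
    zPow V ξ j v ∈ N := uAction_mem N _ hv

theorem seriesSubmodule_succ_le (w : V) (ξ : ℂ) (i : ℕ) :
    seriesSubmodule w ξ (i + 1) ≤ seriesSubmodule w ξ i := by
  refine seriesSubmodule_le ?_
  rw [add_comm, ← zPow_zPow]
  exact zPow_mem_lieSubmodule _ 1 (zPow_mem_seriesSubmodule w ξ i)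

theorem mem_annSz_X_sub_C_pow (w : V) (ξ : ℂ) (i : ℕ) :
    (Polynomial.X - Polynomial.C ξ) ^ i ∈ annSz w ↔ zPow V ξ i w = 0 := by
  change uAction V (Polynomial.aeval (toU z) ((Polynomial.X - Polynomial.C ξ) ^ i)) w = 0 ↔ _
  rw [map_pow, map_sub, Polynomial.aeval_X, Polynomial.aeval_C, zPow_apply]

theorem zPow_eq_zero {a : ℕ}
    (hann : annSz w = Ideal.span {(Polynomial.X - Polynomial.C ξ) ^ a}) : zPow V ξ a w = 0 := by
  rw [← mem_annSz_X_sub_C_pow, hann]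
  exact Ideal.mem_span_singleton_self _

theorem zPow_ne_zero {a i : ℕ}
    (hann : annSz w = Ideal.span {(Polynomial.X - Polynomial.C ξ) ^ a}) (hi : i < a) :
    zPow V ξ i w ≠ 0 := by
  rw [Ne, ← mem_annSz_X_sub_C_pow, hann, Ideal.mem_span_singleton]
  intro h
  exact hi.not_ge ((pow_dvd_pow_iff (Polynomial.X_sub_C_ne_zero ξ)
    (Polynomial.not_isUnit_X_sub_C ξ)).mp h)

theorem seriesSubmodule_eq_bot {a : ℕ}
    (hann : annSz w = Ideal.span {(Polynomial.X - Polynomial.C ξ) ^ a}) :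
    seriesSubmodule w ξ a = ⊥ := by
  refine le_bot_iff.mp (seriesSubmodule_le ?_)
  rw [zPow_eq_zero hann]
  exact LieSubmodule.zero_mem _

/-- Otherwise applying `(z - ξ) ^ (a - 1 - i)` would put `(z - ξ) ^ (a - 1) w ≠ 0` into `V_a = 0`.
-/
theorem zPow_notMem_seriesSubmodule_succ {a i : ℕ}
    (hann : annSz w = Ideal.span {(Polynomial.X - Polynomial.C ξ) ^ a}) (hi : i < a) :
    zPow V ξ i w ∉ seriesSubmodule w ξ (i + 1) := by
  intro h
  have h1 := zPow_mem_seriesSubmodule_add (a - 1 - i) h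
  rw [zPow_zPow, show a - 1 - i + i = a - 1 by omega, show a - 1 - i + (i + 1) = a by omega,
    seriesSubmodule_eq_bot hann, LieSubmodule.mem_bot] at h1
  exact zPow_ne_zero hann (by omega) h1

theorem mk_factor_eq_zero {N N' : LieSubmodule ℂ W22 V} {v : N} :
    (LieSubmodule.Quotient.mk' (N'.comap N.incl) v : factor N N') = 0 ↔ (v : V) ∈ N' :=
  LieSubmodule.Quotient.mk_eq_zero (N'.comap N.incl)

/-- The class of `(z - ξ) ^ i w` in `V_i / V_{i + 1}`. -/
noncomputable def factorVector (w : V) (ξ : ℂ) (i : ℕ) :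
    factor (seriesSubmodule w ξ i) (seriesSubmodule w ξ (i + 1)) :=
  LieSubmodule.Quotient.mk' _ ⟨zPow V ξ i w, zPow_mem_seriesSubmodule w ξ i⟩

theorem isWhittakerVector_factorVector (hw : IsWhittakerVector φ w) (ξ : ℂ) (i : ℕ) :
    IsWhittakerVector φ (factorVector w ξ i) := by
  refine IsWhittakerVector.map (fun x => Subtype.ext ?_) _
  exact hw.map (zPow V ξ i) x

theorem lie_z_factor (i : ℕ)
    (u : factor (seriesSubmodule w ξ i) (seriesSubmodule w ξ (i + 1))) : ⁅z, u⁆ = ξ • u := by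
  obtain ⟨v, rfl⟩ := LieSubmodule.Quotient.surjective_mk' _ u
  rw [← LieModuleHom.map_lie, ← map_smul, ← sub_eq_zero, ← map_sub,
    LieSubmodule.Quotient.mk_eq_zero]
  have h := zPow_mem_seriesSubmodule_add 1 v.2
  rw [zPow_one, add_comm] at h
  exact h

theorem eq_top_of_factorVector_mem {i : ℕ}
    {N : LieSubmodule ℂ W22 (factor (seriesSubmodule w ξ i) (seriesSubmodule w ξ (i + 1)))}
    (hN : factorVector w ξ i ∈ N) : N = ⊤ := by
  refine eq_top_iff.mpr fun u _ => ?_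
  obtain ⟨⟨v, hv⟩, rfl⟩ := LieSubmodule.Quotient.surjective_mk' _ u
  have h : seriesSubmodule w ξ i ≤
      (N.comap (LieSubmodule.Quotient.mk' _)).map (seriesSubmodule w ξ i).incl :=
    seriesSubmodule_le (LieSubmodule.mem_map _ |>.mpr ⟨⟨_, _⟩, hN, rfl⟩)
  obtain ⟨y, hy, rfl⟩ := (LieSubmodule.mem_map _).mp (h hv)
  exact hy

theorem factorVector_ne_zero {a i : ℕ}
    (hann : annSz w = Ideal.span {(Polynomial.X - Polynomial.C ξ) ^ a}) (hi : i < a) :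
    factorVector w ξ i ≠ 0 := fun h =>
  zPow_notMem_seriesSubmodule_succ hann hi (mk_factor_eq_zero.mp h)

/-- A submodule of `V_i` not contained in `V_{i + 1}` is `V_i`, if `V_i / V_{i + 1}` is simple and
`(z - ξ) ^ a w = 0`. -/
theorem eq_seriesSubmodule {a i : ℕ} (hbot : seriesSubmodule w ξ a = ⊥) (hi : i < a)
    (hirr : LieModule.IsIrreducible ℂ W22
      (factor (seriesSubmodule w ξ i) (seriesSubmodule w ξ (i + 1))))
    {N : LieSubmodule ℂ W22 V} (hN : N ≤ seriesSubmodule w ξ i)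
    (hN' : ¬ N ≤ seriesSubmodule w ξ (i + 1)) : N = seriesSubmodule w ξ i := by
  let π := LieSubmodule.Quotient.mk'
    ((seriesSubmodule w ξ (i + 1)).comap (seriesSubmodule w ξ i).incl)
  have htop : (N.comap (seriesSubmodule w ξ i).incl).map π = ⊤ := by
    refine (eq_bot_or_eq_top _).resolve_left fun h => hN' fun v hv => ?_
    have : π ⟨v, hN hv⟩ ∈ (N.comap (seriesSubmodule w ξ i).incl).map π :=
      (LieSubmodule.mem_map _).mpr ⟨⟨v, hN hv⟩, hv, rfl⟩
    rw [h, LieSubmodule.mem_bot] at this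
    exact mk_factor_eq_zero.mp this
  have hmem : factorVector w ξ i ∈ (N.comap (seriesSubmodule w ξ i).incl).map π := by
    rw [htop]; trivial
  obtain ⟨n, hn, hn'⟩ := (LieSubmodule.mem_map _).mp hmem
  -- By simplicity of the factor, `N` contains some `n` congruent to the generator of `V_i` modulo
  -- `V_{i+1}`.
  have hdiff : zPow V ξ i w - n ∈ seriesSubmodule w ξ (i + 1) := by
    have h0 : π (⟨zPow V ξ i w, zPow_mem_seriesSubmodule w ξ i⟩ - n) = 0 := by
      rw [map_sub, hn', sub_eq_zero]
      rfl
    exact mk_factor_eq_zero.mp h0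
  -- Applying `(z - ξ) ^ j` to this congruence gives the generator of `V_{i+j}` modulo `V_{i+j+1}`;
  -- the descent starts at `V_a = 0` and ends at `V_i`.
  have hstep (j : ℕ) (h : seriesSubmodule w ξ (j + i + 1) ≤ N) :
      seriesSubmodule w ξ (j + i) ≤ N := by
    refine seriesSubmodule_le ?_
    have hnN : (n : V) ∈ N := hn
    have h1 := zPow_mem_seriesSubmodule_add j hdiff
    rw [← add_assoc] at h1
    have h2 := N.add_mem (h h1) (zPow_mem_lieSubmodule (ξ := ξ) N j hnN)
    rw [← map_add] at h2
    simpa [zPow_zPow] using h2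
  have hall (j : ℕ) : seriesSubmodule w ξ (j + i) ≤ N → seriesSubmodule w ξ i ≤ N := by
    induction j with
    | zero => simp
    | succ j ih => exact fun h => ih (hstep j (by rwa [add_right_comm] at h))
  refine le_antisymm hN (hall (a - i) ?_)
  rw [Nat.sub_add_cancel hi.le, hbot]
  exact bot_le

end Series

end W22

theorem lemma5p1p1 {V : Type*} [AddCommGroup V] [Module ℂ V] [LieRingModule W22 V]
    [LieModule ℂ W22 V] (φ : W22.plus →ₗ⁅ℂ⁆ ℂ) (w : V) (hw : W22.IsCyclicWhittakerVector φ w)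
    (ξ : ℂ) (a : ℕ) (ha : 0 < a)
    (hann : W22.annSz w = Ideal.span {(Polynomial.X - Polynomial.C ξ) ^ a}) :
    (W22.seriesSubmodule w ξ 0 = ⊤ ∧ W22.seriesSubmodule w ξ a = ⊥ ∧
      ∀ i < a,
        W22.seriesSubmodule w ξ (i + 1) < W22.seriesSubmodule w ξ i ∧
        LieModule.IsIrreducible ℂ W22
          (W22.factor (W22.seriesSubmodule w ξ i) (W22.seriesSubmodule w ξ (i + 1))) ∧
        Nonempty
          (W22.factor (W22.seriesSubmodule w ξ i) (W22.seriesSubmodule w ξ (i + 1))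
            ≃ₗ⁅ℂ, W22⁆ W22.simpleQuotient φ ξ)) ∧
    ∀ N : LieSubmodule ℂ W22 V, ∃ i ≤ a, N = W22.seriesSubmodule w ξ i := by
  have hirr (i : ℕ) (hi : i < a) :=
    (W22.isWhittakerVector_factorVector hw.isWhittakerVector ξ i).isIrreducible hw.nonsingular
      (W22.lie_z_factor i) (fun _ => W22.eq_top_of_factorVector_mem)
      (W22.factorVector_ne_zero hann hi)
  have htop : W22.seriesSubmodule w ξ 0 = ⊤ := by
    rw [← hw.cyclic, W22.seriesSubmodule, pow_zero, map_one, Module.End.one_apply]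
  have hbot := W22.seriesSubmodule_eq_bot hann
  refine ⟨⟨htop, hbot, fun i hi => ⟨?_, hirr i hi, ?_⟩⟩, fun N => ?_⟩
  · exact lt_of_le_of_ne (W22.seriesSubmodule_succ_le w ξ i) fun h =>
      W22.zPow_notMem_seriesSubmodule_succ hann hi (h ▸ W22.zPow_mem_seriesSubmodule w ξ i)
  · exact (W22.isWhittakerVector_factorVector hw.isWhittakerVector ξ i).nonempty_equiv
      hw.nonsingular (W22.lie_z_factor i) (fun _ => W22.eq_top_of_factorVector_mem)
      (W22.factorVector_ne_zero hann hi)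
  · by_contra! hN
    -- If `N` equals no `V_i`, it can never fail to pass from `V_i` to `V_{i+1}`, so it lies in `V_a
    -- = 0`, and then equals `V_a`.
    have hle (i : ℕ) : i ≤ a → N ≤ W22.seriesSubmodule w ξ i := by
      induction i with
      | zero => exact fun _ => htop ▸ le_top
      | succ i ih =>
        intro hi
        by_contra hN'
        exact hN i (by omega) (W22.eq_seriesSubmodule hbot hi (hirr i hi) (ih (by omega)) hN')
    exact hN a le_rfl (le_antisymm (hle a le_rfl) (hbot ▸ bot_le))
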